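/- A dyadic interval is an interval $[k2^{j},(k+1)2^{j})$ with $j,k\in\mathbb{Z}$; $h_I=|I|^{-1/2}(\chi_{I_{\mathrm{left}}}-\chi_{I_{\mathrm{right}}})$ is its Haar function. For a dyadic rectangle $R=I\times J$ put $h_R=h_I\otimes h_J$ and let $|R|$ be its area. A dyadic distribution is a family $f=\{f_R\}$ of real numbers indexed by all dyadic rectangles; a locally integrable function $F$ on $\mathbb{R}^2$ is regarded as the dyadic distribution of its Haar coefficients $F_R=\int F\,h_R$. The space $BMO_d(\mathbb{R}\otimes\mathbb{R})$ consists of all dyadic distributions $f$ with $$\|f\|_{BMO_d}:=\sup_{\Omega}\Big(\frac1{|\Omega|}\sum_{R\subseteq\Omega}f_R^2\Big)^{1/2}<\infty,$$ where $\Omega$ runs over all nonempty open subsets of $\mathbb{R}^2$ of finite measure. Corollary. There are absolute constants $0<c\le C<\infty$ such that the following holds. Let $g$ be a locally integrable real function on $\mathbb{R}^2$ with only finitely many non-zero Haar coefficients $g_R$, and for a dyadic distribution $f$ let $$\pi_g^*(f):=\sum_{R}f_R\,g_R\,\frac{\chi_R}{|R|}$$ (a finite sum, regarded as a dyadic distribution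 through its Haar coefficients). Then $$c\,\|g\|_{BMO_d}\le\|\pi_g^*\|_{BMO_d(\mathbb{R}\otimes\mathbb{R})\to BMO_d(\mathbb{R}\otimes\mathbb{R})}\le C\,\|g\|_{BMO_d},$$ where the operator norm is the least constant $K\ge0$ with $\|\pi_g^*(f)\|_{BMO_d}\le K\|f\|_{BMO_d}$ for all $f\in BMO_d(\mathbb{R}\otimes\mathbb{R})$. -/

import Mathlib

open MeasureTheory
open scoped ENNReal NNReal

noncomputable section

namespace BiParam

/-- The dyadic interval `[pos * 2 ^ scale, (pos + 1) * 2 ^ scale)` of the real line. -/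
@[ext] structure DyadicInterval where
  scale : ℤ
  pos : ℤ

namespace DyadicInterval

/-- The length `|I|`. -/
def length (I : DyadicInterval) : ℝ := (2 : ℝ) ^ I.scale

/-- The underlying set of points. -/
def toSet (I : DyadicInterval) : Set ℝ :=
  Set.Ico ((I.pos : ℝ) * (2 : ℝ) ^ I.scale) (((I.pos : ℝ) + 1) * (2 : ℝ) ^ I.scale)

/-- The left half of `I`. -/
def left (I : DyadicInterval) : DyadicInterval := ⟨I.scale - 1, 2 * I.pos⟩

/-- The right half of `I`. -/
def right (I : DyadicInterval) : DyadicInterval := ⟨I.scale - 1, 2 * I.pos + 1⟩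

/-- The `L²`-normalized Haar wavelet `h_I = |I|^{-1/2} (χ_{left half} - χ_{right half})`. -/
def haar (I : DyadicInterval) (x : ℝ) : ℝ :=
  (Real.sqrt I.length)⁻¹ *
    (I.left.toSet.indicator (fun _ => (1 : ℝ)) x - I.right.toSet.indicator (fun _ => (1 : ℝ)) x)

end DyadicInterval

/-- A dyadic rectangle `R = I × J`. -/
abbrev DyadicRectangle : Type := DyadicInterval × DyadicInterval

namespace DyadicRectangle

/-- The underlying set of points of the plane. -/
def toSet (R : DyadicRectangle) : Set (ℝ × ℝ) := R.1.toSet ×ˢ R.2.toSet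

/-- The area `|R|`. -/
def area (R : DyadicRectangle) : ℝ := R.1.length * R.2.length

/-- The Haar function `h_R = h_I ⊗ h_J`. -/
def haar (R : DyadicRectangle) (x : ℝ × ℝ) : ℝ := R.1.haar x.1 * R.2.haar x.2

end DyadicRectangle

/-- A dyadic distribution: a family of numbers indexed by the dyadic rectangles,
formally `∑ R, f R * h_R`. -/
abbrev DyadicDistribution : Type := DyadicRectangle → ℝ

/-- The family of Haar coefficients `F_R = ⟨F, h_R⟩` of a (locally integrable) function. -/
def haarCoeff (F : ℝ × ℝ → ℝ) : DyadicDistribution :=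
  fun R => ∫ x, F x * DyadicRectangle.haar R x

/-- The bi-parameter dyadic `BMO` norm, with values in `[0, ∞]`: the supremum over all nonempty
open sets `Ω` of finite area of `(|Ω|⁻¹ ∑_{R ⊆ Ω} f_R²)^{1/2}`. -/
def bmoNorm (f : DyadicDistribution) : ℝ≥0∞ :=
  ⨆ (Ω : Set (ℝ × ℝ)) (_ : IsOpen Ω) (_ : Ω.Nonempty) (_ : volume Ω < ∞),
    ((volume Ω)⁻¹ *
      ∑' R : {R : DyadicRectangle // DyadicRectangle.toSet R ⊆ Ω},
        ENNReal.ofReal (f R.1 ^ 2)) ^ (1 / 2 : ℝ)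

/-- The space `BMO_d(ℝ ⊗ ℝ)`. -/
def BMO : Set DyadicDistribution := {f | bmoNorm f < ∞}

/-- The function `π_g^*(f) = ∑_R f_R g_R χ_R / |R|`, for `g` with finitely many nonzero terms. -/
def piStarFun (g f : DyadicDistribution) (x : ℝ × ℝ) : ℝ :=
  ∑ᶠ R : DyadicRectangle,
    f R * g R * ((DyadicRectangle.toSet R).indicator (fun _ => (1 : ℝ)) x
      / DyadicRectangle.area R)

/-- The operator `π_g^*` on dyadic distributions: `f` is sent to the function `π_g^*(f)`,
seen as a dyadic distribution through its Haar coefficients. -/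
def piStar (g : DyadicDistribution) : DyadicDistribution → DyadicDistribution :=
  fun f => haarCoeff (piStarFun g f)

/-- The operator norm on `BMO_d(ℝ ⊗ ℝ)`: the infimum of the finite constants `K` with
`‖T f‖ ≤ K ‖f‖` for all `f` in the space (it is `∞` if there are none). -/
def bmoOpNorm (T : DyadicDistribution → DyadicDistribution) : ℝ≥0∞ :=
  ⨅ (K : ℝ≥0) (_ : ∀ f ∈ BMO, bmoNorm (T f) ≤ K * bmoNorm f), (K : ℝ≥0∞)

end BiParam

end

namespace BiParam

/-! ### Dyadic intervals: nesting, ancestors and halves -/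

namespace DyadicInterval

/-! Upper bound. By Cauchy–Schwarz the products `|f_R g_R|` form a Carleson family with constant `A
= ‖f‖ ‖g‖`: their sum over any finite family of rectangles is at most `A` times the area of the
union. The sweep `S = ∑ β_R χ_R / |R|` of such a family satisfies `∫ S² ≤ 64 A² |⋃ R|`. Indeed `∫
S²` is the sum of `β_R` times the average of `S` over `R`; Carleson embedding bounds this by `A ∫ W`
over the union, `W` being the iterated dyadic maximal function of `S`, and the `L²` bound for `W`
lets the term be absorbed (`lintegral_sweep_sq_le`). Since `χ_R` has a nonzero coefficient at `Q`
only if `R ⊆ Q`, the coefficients with `Q ⊆ Ω` see only rectangles `R ⊆ Ω`, and Bessel's inequality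
finishes.

Lower bound. Test the operator on `f`, the restriction of `g` to a finite family `s` of rectangles
inside `Ω`. Then `F = π_g^*(f)` has integral `∑ g_R²` and lives on the union `U` of `s`, so `(∑
g_R²)² ≤ |U| ∫ F²`. What remains is to bound `∫ F²` by the `BMO` norm `N` of `F`, although `F` also
has coefficients at rectangles far larger than `U` (`ofReal_integral_sq_le`). Coefficients inside an
enlargement of `U` of comparable area are controlled by `N`. The remaining Haar sum `w` is constant,
one variable at a time, on intervals where `U` or its set of dense heights has small density. So `w`
has little mass on `U`, and as `F` lives on `U`, these coefficients carry at most half of `∫ F²`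
(`two_mul_sum_haarCoeff_sq_le`). Parseval for combinations of indicators then absorbs that half. The
result is `‖g‖² ≤ 32 K ‖g‖`, and the finite norm of `g` can be cancelled. -/

instance : Countable DyadicInterval :=
  Function.Injective.countable (f := fun I : DyadicInterval => (I.scale, I.pos)) (by
    rintro ⟨a, b⟩ ⟨c, d⟩ h
    simpa using h)

lemma length_pos (I : DyadicInterval) : 0 < I.length := zpow_pos two_pos _

lemma length_ne_zero (I : DyadicInterval) : I.length ≠ 0 := I.length_pos.ne'

lemma mem_toSet {I : DyadicInterval} {x : ℝ} :
    x ∈ I.toSet ↔ (I.pos : ℝ) * I.length ≤ x ∧ x < ((I.pos : ℝ) + 1) * I.length := Iff.rfl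

lemma measurableSet_toSet (I : DyadicInterval) : MeasurableSet I.toSet := measurableSet_Ico

lemma volume_toSet (I : DyadicInterval) : volume I.toSet = ENNReal.ofReal I.length := by
  simp only [toSet, Real.volume_Ico, length]
  congr 1
  ring

lemma volume_toSet_ne_top (I : DyadicInterval) : volume I.toSet ≠ ∞ := by
  simp [volume_toSet]

lemma volume_toSet_ne_zero (I : DyadicInterval) : volume I.toSet ≠ 0 := by
  simp [volume_toSet, I.length_pos]

lemma toSet_nonempty (I : DyadicInterval) : I.toSet.Nonempty := by
  refine ⟨I.pos * I.length, le_rfl, ?_⟩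
  have := I.length_pos
  change (I.pos : ℝ) * I.length < (I.pos + 1) * I.length
  linarith

/-- Dyadic intervals with a common point are nested. -/
lemma toSet_subset_of_mem {K L : DyadicInterval} (h : K.scale ≤ L.scale) {x : ℝ}
    (hK : x ∈ K.toSet) (hL : x ∈ L.toSet) : K.toSet ⊆ L.toSet := by
  obtain ⟨n, hn⟩ : ∃ n : ℕ, L.scale = K.scale + n :=
    ⟨(L.scale - K.scale).toNat, by omega⟩
  -- In units of `|K|` the endpoints of both intervals are integers, so the strict inequalities
  -- given by the common point sharpen to the nonstrict ones between endpoints.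
  have hlen : L.length = ((2 ^ n : ℤ) : ℝ) * K.length := by
    simp only [length, hn, zpow_add₀ (two_ne_zero : (2 : ℝ) ≠ 0), zpow_natCast]
    push_cast
    ring
  have hpos := K.length_pos
  rw [mem_toSet] at hK hL
  rw [hlen, ← mul_assoc, ← mul_assoc] at hL
  have h1 : ((L.pos * 2 ^ n : ℤ) : ℝ) < ((K.pos + 1 : ℤ) : ℝ) := by
    have := lt_of_mul_lt_mul_right (hL.1.trans_lt hK.2) hpos.le
    push_cast at this ⊢
    exact this
  have h2 : ((K.pos : ℤ) : ℝ) < (((L.pos + 1) * 2 ^ n : ℤ) : ℝ) := by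
    have := lt_of_mul_lt_mul_right (hK.1.trans_lt hL.2) hpos.le
    push_cast at this ⊢
    exact this
  have h1' : ((L.pos * 2 ^ n : ℤ) : ℝ) ≤ (K.pos : ℝ) := by
    exact_mod_cast Int.lt_add_one_iff.mp (by exact_mod_cast h1)
  have h2' : ((K.pos : ℝ) + 1) ≤ (((L.pos + 1) * 2 ^ n : ℤ) : ℝ) := by
    exact_mod_cast Int.add_one_le_iff.mpr (by exact_mod_cast h2)
  intro y hy
  rw [mem_toSet] at hy ⊢
  rw [hlen, ← mul_assoc, ← mul_assoc]
  push_cast at h1' h2' ⊢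
  exact ⟨(mul_le_mul_of_nonneg_right h1' hpos.le).trans hy.1,
    hy.2.trans_le (mul_le_mul_of_nonneg_right h2' hpos.le)⟩

/-- Two points of `K` lie in the same dyadic intervals that are at least as long as `K`. -/
lemma mem_iff_mem {K L : DyadicInterval} (h : K.scale ≤ L.scale) {x y : ℝ}
    (hx : x ∈ K.toSet) (hy : y ∈ K.toSet) : x ∈ L.toSet ↔ y ∈ L.toSet :=
  ⟨fun hL => toSet_subset_of_mem h hx hL hy, fun hL => toSet_subset_of_mem h hy hL hx⟩

lemma scale_le_of_subset {K L : DyadicInterval} (h : K.toSet ⊆ L.toSet) :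
    K.scale ≤ L.scale := by
  have := measure_mono (μ := volume) h
  rw [volume_toSet, volume_toSet, ENNReal.ofReal_le_ofReal_iff L.length_pos.le] at this
  exact (zpow_le_zpow_iff_right₀ one_lt_two).mp this

lemma toSet_injective : Function.Injective toSet := by
  intro K L h
  have hs : K.scale = L.scale :=
    le_antisymm (scale_le_of_subset h.le) (scale_le_of_subset h.ge)
  have hl : K.length = L.length := by simp [length, hs]
  have hK := K.length_pos
  ext
  · exact hs
  have h1 : (K.pos : ℝ) * K.length ∈ L.toSet := by
    rw [← h]
    refine ⟨le_rfl, ?_⟩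
    change (K.pos : ℝ) * K.length < (K.pos + 1) * K.length
    linarith
  rw [mem_toSet, ← hl] at h1
  have h2 := le_of_mul_le_mul_right h1.1 hK
  have h3 := lt_of_mul_lt_mul_right h1.2 hK.le
  have h4 : L.pos ≤ K.pos := by exact_mod_cast h2
  have h5 : K.pos < L.pos + 1 := by exact_mod_cast h3
  omega

lemma eq_of_mem_of_scale_eq {K L : DyadicInterval} (h : K.scale = L.scale) {x : ℝ}
    (hK : x ∈ K.toSet) (hL : x ∈ L.toSet) : K = L :=
  toSet_injective ((toSet_subset_of_mem h.le hK hL).antisymm (toSet_subset_of_mem h.ge hL hK))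

/-- The dyadic interval of length `2 ^ n` containing `x`. -/
noncomputable def around (n : ℤ) (x : ℝ) : DyadicInterval := ⟨n, ⌊x / 2 ^ n⌋⟩

lemma mem_around (n : ℤ) (x : ℝ) : x ∈ (around n x).toSet := by
  have h : (0 : ℝ) < 2 ^ n := zpow_pos two_pos _
  rw [mem_toSet]
  simp only [around, length]
  exact ⟨(le_div_iff₀ h).mp (Int.floor_le _), (div_lt_iff₀ h).mp (Int.lt_floor_add_one _)⟩

/-- The dyadic interval of twice the length that contains `I`. -/
noncomputable def parent (I : DyadicInterval) : DyadicInterval :=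
  around (I.scale + 1) (I.pos * I.length)

lemma scale_parent (I : DyadicInterval) : I.parent.scale = I.scale + 1 := rfl

lemma length_parent (I : DyadicInterval) : I.parent.length = 2 * I.length := by
  simp only [length, scale_parent, zpow_add₀ (two_ne_zero : (2 : ℝ) ≠ 0)]
  ring

lemma subset_parent (I : DyadicInterval) : I.toSet ⊆ I.parent.toSet := by
  refine toSet_subset_of_mem (x := I.pos * I.length) (by simp [scale_parent]) ?_ (mem_around _ _)
  refine ⟨le_rfl, ?_⟩
  have := I.length_pos
  change (I.pos : ℝ) * I.length < (I.pos + 1) * I.length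
  linarith

lemma length_left (I : DyadicInterval) : I.left.length = I.length / 2 := by
  simp [length, left, zpow_sub₀ (two_ne_zero : (2 : ℝ) ≠ 0)]

lemma length_right (I : DyadicInterval) : I.right.length = I.length / 2 := by
  simp [length, right, zpow_sub₀ (two_ne_zero : (2 : ℝ) ≠ 0)]

lemma mem_left {I : DyadicInterval} {x : ℝ} :
    x ∈ I.left.toSet ↔ I.pos * I.length ≤ x ∧ x < I.pos * I.length + I.length / 2 := by
  rw [mem_toSet, length_left]
  simp only [left]
  push_cast
  ring_nf

lemma mem_right {I : DyadicInterval} {x : ℝ} :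
    x ∈ I.right.toSet ↔
      I.pos * I.length + I.length / 2 ≤ x ∧ x < I.pos * I.length + I.length := by
  rw [mem_toSet, length_right]
  simp only [right]
  push_cast
  ring_nf

lemma mem_toSet' {I : DyadicInterval} {x : ℝ} :
    x ∈ I.toSet ↔ I.pos * I.length ≤ x ∧ x < I.pos * I.length + I.length := by
  rw [mem_toSet]
  ring_nf

lemma left_subset (I : DyadicInterval) : I.left.toSet ⊆ I.toSet := by
  intro x hx
  rw [mem_left] at hx
  rw [mem_toSet']
  have := I.length_pos
  exact ⟨hx.1, by linarith [hx.2]⟩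

lemma right_subset (I : DyadicInterval) : I.right.toSet ⊆ I.toSet := by
  intro x hx
  rw [mem_right] at hx
  rw [mem_toSet']
  have := I.length_pos
  exact ⟨by linarith [hx.1], hx.2⟩

/-! ### Maximal dense intervals and the weak type inequality -/

/-- The members of a family that lie in no other member. -/
def maximals (S : Set DyadicInterval) : Set DyadicInterval :=
  {K ∈ S | ∀ L ∈ S, K.toSet ⊆ L.toSet → L = K}

/-- Scales are integers bounded by `N`, so among the members containing `K` one has largest scale;
nestedness makes it maximal. -/
lemma exists_mem_maximals {S : Set DyadicInterval} {N : ℤ} (hN : ∀ K ∈ S, K.scale ≤ N)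
    {K : DyadicInterval} (hK : K ∈ S) : ∃ L ∈ maximals S, K.toSet ⊆ L.toSet := by
  obtain ⟨m, ⟨L, hLS, hKL, rfl⟩, hmax⟩ := Int.exists_greatest_of_bdd
    (P := fun m => ∃ L ∈ S, K.toSet ⊆ L.toSet ∧ L.scale = m)
    ⟨N, by rintro _ ⟨L, hL, -, rfl⟩; exact hN L hL⟩ ⟨_, K, hK, subset_rfl, rfl⟩
  refine ⟨L, ⟨hLS, fun L' hL' hLL' => ?_⟩, hKL⟩
  obtain ⟨x, hx⟩ := L.toSet_nonempty
  exact eq_of_mem_of_scale_eq (le_antisymm (hmax _ ⟨L', hL', hKL.trans hLL', rfl⟩)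
    (scale_le_of_subset hLL')) (hLL' hx) hx

lemma pairwiseDisjoint_maximals (S : Set DyadicInterval) :
    (maximals S).PairwiseDisjoint toSet := by
  intro K hK L hL hne
  rw [Function.onFun, Set.disjoint_left]
  intro x hxK hxL
  rcases le_total K.scale L.scale with h | h
  · exact hne (hK.2 L hL.1 (toSet_subset_of_mem h hxK hxL)).symm
  · exact hne (hL.2 K hK.1 (toSet_subset_of_mem h hxL hxK))

lemma biUnion_maximals {S : Set DyadicInterval} {N : ℤ} (hN : ∀ K ∈ S, K.scale ≤ N) :
    ⋃ K ∈ S, K.toSet = ⋃ K ∈ maximals S, K.toSet := by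
  refine subset_antisymm (Set.iUnion₂_subset fun K hK => ?_)
    (Set.biUnion_subset_biUnion_left fun K hK => hK.1)
  obtain ⟨L, hL, hKL⟩ := exists_mem_maximals hN hK
  exact hKL.trans (Set.subset_biUnion_of_mem (u := toSet) hL)

/-- The dyadic intervals whose `ν`-density exceeds `t`. -/
def dense (ν : Measure ℝ) (t : ℝ≥0∞) : Set DyadicInterval :=
  {K | t * volume K.toSet < ν K.toSet}

/-- A dense interval has length at most `ν(ℝ) / t`. This is what makes maximal dense intervals
exist. -/
lemma exists_scale_le_of_mem_dense {ν : Measure ℝ} (hν : ν Set.univ ≠ ∞) {t : ℝ≥0∞}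
    (ht : t ≠ 0) : ∃ N : ℤ, ∀ K ∈ dense ν t, K.scale ≤ N := by
  have hfin : ν Set.univ / t < ∞ := ENNReal.div_lt_top hν ht
  obtain ⟨n, hn⟩ := pow_unbounded_of_one_lt (ν Set.univ / t).toReal (one_lt_two : (1 : ℝ) < 2)
  refine ⟨n, fun K hK => ?_⟩
  have h1 : volume K.toSet < ENNReal.ofReal (2 ^ n) := by
    calc volume K.toSet ≤ ν Set.univ / t := by
          have ht' : t ≠ ∞ := by
            rintro rfl
            have : (∞ : ℝ≥0∞) * volume K.toSet < ν K.toSet := hK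
            rw [ENNReal.top_mul K.volume_toSet_ne_zero] at this
            exact not_top_lt this
          rw [ENNReal.le_div_iff_mul_le (Or.inl ht) (Or.inl ht'), mul_comm]
          exact (le_of_lt hK).trans (measure_mono (Set.subset_univ _))
      _ < _ := by
          rw [← ENNReal.ofReal_toReal hfin.ne]
          exact (ENNReal.ofReal_lt_ofReal_iff (by positivity)).mpr hn
  rw [volume_toSet, ENNReal.ofReal_lt_ofReal_iff (by positivity), length,
    ← zpow_natCast, zpow_lt_zpow_iff_right₀ one_lt_two] at h1
  exact h1.le

/-- The weak type inequality for the dyadic maximal function of a measure. -/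
lemma volume_biUnion_dense_le (ν : Measure ℝ) (t : ℝ≥0∞) :
    t * volume (⋃ K ∈ dense ν t, K.toSet) ≤ ν Set.univ := by
  rcases eq_or_ne (ν Set.univ) ∞ with hν | hν
  · simp [hν]
  rcases eq_or_ne t 0 with rfl | ht
  · simp
  obtain ⟨N, hN⟩ := exists_scale_le_of_mem_dense hν ht
  rw [biUnion_maximals hN, measure_biUnion (Set.to_countable _) (pairwiseDisjoint_maximals _)
    (fun K _ => K.measurableSet_toSet), ← ENNReal.tsum_mul_left]
  calc ∑' K : maximals (dense ν t), t * volume K.1.toSet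
      ≤ ∑' K : maximals (dense ν t), ν K.1.toSet :=
        ENNReal.tsum_le_tsum fun K => le_of_lt K.2.1
    _ = ν (⋃ K ∈ maximals (dense ν t), K.toSet) :=
        (measure_biUnion (Set.to_countable _) (pairwiseDisjoint_maximals _)
          (fun K _ => K.measurableSet_toSet)).symm
    _ ≤ _ := measure_mono (Set.subset_univ _)

/-- A maximal interval of density exceeding `t` has density at most `2 * t`. -/
lemma measure_le_of_mem_maximals_dense {ν : Measure ℝ} {t : ℝ≥0∞} {K : DyadicInterval}
    (hK : K ∈ maximals (dense ν t)) : ν K.toSet ≤ 2 * t * volume K.toSet := by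
  -- A dense parent would contradict maximality; passing to the parent doubles the length, whence
  -- the factor 2.
  have hp : K.parent ∉ dense ν t := by
    intro h
    have := congrArg scale (hK.2 _ h K.subset_parent)
    simp [scale_parent] at this
  calc ν K.toSet ≤ ν K.parent.toSet := measure_mono K.subset_parent
    _ ≤ t * volume K.parent.toSet := not_lt.mp hp
    _ = 2 * t * volume K.toSet := by
        rw [volume_toSet, volume_toSet, length_parent, ENNReal.ofReal_mul zero_le_two]
        simp only [ENNReal.ofReal_ofNat]
        ring

/-! ### Indicators and Haar functions on the line -/

/-- The indicator function of a dyadic interval. -/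
noncomputable def ind (I : DyadicInterval) : ℝ → ℝ := I.toSet.indicator fun _ => 1

lemma memLp_ind (I : DyadicInterval) : MemLp I.ind 2 volume :=
  memLp_indicator_const _ I.measurableSet_toSet _ (Or.inr I.volume_toSet_ne_top)

lemma measurable_ind (I : DyadicInterval) : Measurable I.ind :=
  measurable_const.indicator I.measurableSet_toSet

lemma ind_of_mem {I : DyadicInterval} {x : ℝ} (h : x ∈ I.toSet) : I.ind x = 1 :=
  Set.indicator_of_mem h _

lemma ind_of_notMem {I : DyadicInterval} {x : ℝ} (h : x ∉ I.toSet) : I.ind x = 0 :=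
  Set.indicator_of_notMem h _

lemma integrable_ind (I : DyadicInterval) : Integrable I.ind :=
  (integrable_indicator_iff I.measurableSet_toSet).mpr
    (integrableOn_const I.volume_toSet_ne_top)

lemma integral_ind (I : DyadicInterval) : ∫ x, I.ind x = I.length := by
  simp [ind, integral_indicator I.measurableSet_toSet, Measure.real, volume_toSet, I.length_pos.le]

lemma haar_eq (I : DyadicInterval) :
    I.haar = fun x => (Real.sqrt I.length)⁻¹ * (I.left.ind x - I.right.ind x) := rfl

lemma memLp_haar (I : DyadicInterval) : MemLp I.haar 2 volume :=
  (I.left.memLp_ind.sub I.right.memLp_ind).const_mul _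

lemma measurable_haar (I : DyadicInterval) : Measurable I.haar :=
  (I.left.measurable_ind.sub I.right.measurable_ind).const_mul _

lemma haar_of_notMem {I : DyadicInterval} {x : ℝ} (h : x ∉ I.toSet) : I.haar x = 0 := by
  rw [haar_eq]
  simp only
  rw [ind_of_notMem (fun h' => h (I.left_subset h')),
    ind_of_notMem (fun h' => h (I.right_subset h'))]
  simp

lemma ind_eq_of_mem {K L : DyadicInterval} (h : K.scale ≤ L.scale) {x y : ℝ}
    (hx : x ∈ K.toSet) (hy : y ∈ K.toSet) : L.ind x = L.ind y := by
  have := mem_iff_mem h hx hy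
  by_cases hL : x ∈ L.toSet
  · rw [ind_of_mem hL, ind_of_mem (this.mp hL)]
  · rw [ind_of_notMem hL, ind_of_notMem (fun h => hL (this.mpr h))]

/-- The Haar function of `I` is constant on each dyadic interval that does not contain `I`. -/
lemma haar_eq_of_mem {I K : DyadicInterval} (h : ¬ I.toSet ⊆ K.toSet) {x y : ℝ}
    (hx : x ∈ K.toSet) (hy : y ∈ K.toSet) : I.haar x = I.haar y := by
  rcases le_or_gt I.scale K.scale with hs | hs
  · have key : ∀ z ∈ K.toSet, I.haar z = 0 := fun z hz =>
      haar_of_notMem fun hI => h (toSet_subset_of_mem hs hI hz)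
    rw [key x hx, key y hy]
  · have hs' : K.scale ≤ I.scale - 1 := by omega
    simp only [haar_eq]
    rw [ind_eq_of_mem (L := I.left) hs' hx hy, ind_eq_of_mem (L := I.right) hs' hx hy]

lemma integral_haar (I : DyadicInterval) : ∫ x, I.haar x = 0 := by
  simp only [haar_eq]
  rw [integral_const_mul, integral_sub I.left.integrable_ind I.right.integrable_ind,
    integral_ind, integral_ind, length_left, length_right]
  simp

lemma notMem_of_notMem_halves {I : DyadicInterval} {x : ℝ} (h1 : x ∉ I.left.toSet)
    (h2 : x ∉ I.right.toSet) : x ∉ I.toSet := by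
  rw [mem_left] at h1
  rw [mem_right] at h2
  rw [mem_toSet']
  rintro ⟨h4, h5⟩
  rcases lt_or_ge x (I.pos * I.length + I.length / 2) with h6 | h6
  · exact h1 ⟨h4, h6⟩
  · exact h2 ⟨h6, h5⟩

lemma haar_sq (I : DyadicInterval) (x : ℝ) : I.haar x * I.haar x = I.length⁻¹ * I.ind x := by
  have hs : (Real.sqrt I.length)⁻¹ * (Real.sqrt I.length)⁻¹ = I.length⁻¹ := by
    rw [← mul_inv, Real.mul_self_sqrt I.length_pos.le]
  have hl := I.length_pos
  by_cases h1 : x ∈ I.left.toSet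
  · have h2 : x ∉ I.right.toSet := by
      rw [mem_left] at h1
      rw [mem_right]
      intro h
      linarith [h.1, h1.2]
    simp only [haar_eq]
    rw [ind_of_mem h1, ind_of_notMem h2, ind_of_mem (I.left_subset h1), ← hs]
    ring
  · by_cases h2 : x ∈ I.right.toSet
    · simp only [haar_eq]
      rw [ind_of_notMem h1, ind_of_mem h2, ind_of_mem (I.right_subset h2), ← hs]
      ring
    · have h3 := notMem_of_notMem_halves h1 h2
      rw [haar_of_notMem h3, ind_of_notMem h3]
      simp

lemma integral_haar_mul_self (I : DyadicInterval) : ∫ x, I.haar x * I.haar x = 1 := by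
  simp only [haar_sq]
  rw [integral_const_mul, integral_ind, inv_mul_cancel₀ I.length_ne_zero]

/-- A function that is constant on `J` is orthogonal to the Haar function of `J`. -/
lemma integral_mul_haar_eq_zero {φ : ℝ → ℝ} {J : DyadicInterval}
    (h : ∀ x ∈ J.toSet, ∀ y ∈ J.toSet, φ x = φ y) : ∫ x, φ x * J.haar x = 0 := by
  obtain ⟨z, hz⟩ := J.toSet_nonempty
  have : (fun x => φ x * J.haar x) = fun x => φ z * J.haar x := by
    funext x
    by_cases hx : x ∈ J.toSet
    · rw [h x hx z hz]
    · simp [haar_of_notMem hx]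
  rw [this, integral_const_mul, integral_haar, mul_zero]

lemma integral_haar_mul_haar {I J : DyadicInterval} (h : I ≠ J) :
    ∫ x, I.haar x * J.haar x = 0 := by
  by_cases hIJ : I.toSet ⊆ J.toSet
  · have hJI : ¬ J.toSet ⊆ I.toSet := fun h' => h (toSet_injective (hIJ.antisymm h'))
    simp only [mul_comm (I.haar _)]
    exact integral_mul_haar_eq_zero fun x hx y hy => haar_eq_of_mem hJI hx hy
  · exact integral_mul_haar_eq_zero fun x hx y hy => haar_eq_of_mem hIJ hx hy

lemma eq_left_or_right (I : DyadicInterval) : I = I.parent.left ∨ I = I.parent.right := by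
  obtain ⟨x, hx⟩ := I.toSet_nonempty
  have hp := I.subset_parent hx
  rw [mem_toSet'] at hp
  rcases lt_or_ge x (I.parent.pos * I.parent.length + I.parent.length / 2) with h | h
  · exact Or.inl (eq_of_mem_of_scale_eq (by simp [left, scale_parent]) hx
      (mem_left.mpr ⟨hp.1, h⟩))
  · exact Or.inr (eq_of_mem_of_scale_eq (by simp [right, scale_parent]) hx
      (mem_right.mpr ⟨h, hp.2⟩))

lemma ind_eq_left_add_right (I : DyadicInterval) (x : ℝ) :
    I.ind x = I.left.ind x + I.right.ind x := by
  by_cases h1 : x ∈ I.left.toSet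
  · have h2 : x ∉ I.right.toSet := fun h2 =>
      (mem_left.mp h1).2.not_ge (mem_right.mp h2).1
    rw [ind_of_mem h1, ind_of_notMem h2, ind_of_mem (I.left_subset h1), add_zero]
  · by_cases h2 : x ∈ I.right.toSet
    · rw [ind_of_notMem h1, ind_of_mem h2, ind_of_mem (I.right_subset h2), zero_add]
    · rw [ind_of_notMem h1, ind_of_notMem h2, ind_of_notMem (notMem_of_notMem_halves h1 h2),
        add_zero]

/-- One step of the Haar expansion of the indicator function of `I`. -/
lemma exists_ind_eq (I : DyadicInterval) :
    ∃ c : ℝ, ∀ x, I.ind x = 2⁻¹ * I.parent.ind x + c * I.parent.haar x := by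
  have hs : Real.sqrt I.parent.length ≠ 0 := (Real.sqrt_pos.mpr I.parent.length_pos).ne'
  rcases I.eq_left_or_right with h | h
  · refine ⟨Real.sqrt I.parent.length / 2, fun x => ?_⟩
    rw [ind_eq_left_add_right I.parent, haar_eq]
    conv_lhs => rw [h]
    field_simp
    ring
  · refine ⟨-(Real.sqrt I.parent.length / 2), fun x => ?_⟩
    rw [ind_eq_left_add_right I.parent, haar_eq]
    conv_lhs => rw [h]
    field_simp
    ring

end DyadicInterval

/-! ### Dyadic rectangles, orthonormality and Bessel's inequality -/

open DyadicInterval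

/-- The norm of a finite sum of orthonormal functions. -/
lemma integral_sum_sq {α ι : Type*} [MeasurableSpace α] {μ : Measure α} {e : ι → α → ℝ}
    (he : ∀ i, MemLp (e i) 2 μ) (h1 : ∀ i, ∫ x, e i x * e i x ∂μ = 1)
    (h0 : ∀ i j, i ≠ j → ∫ x, e i x * e j x ∂μ = 0) (s : Finset ι) (a : ι → ℝ) :
    ∫ x, (∑ i ∈ s, a i * e i x) ^ 2 ∂μ = ∑ i ∈ s, a i ^ 2 := by
  have hint : ∀ i j, Integrable (fun x => a i * e i x * (a j * e j x)) μ := fun i j =>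
    ((he i).const_mul (a i)).integrable_mul ((he j).const_mul (a j))
  simp only [pow_two, Finset.sum_mul_sum]
  rw [integral_finsetSum _ fun i _ => integrable_finsetSum _ fun j _ => hint i j]
  have hmul : ∀ i j, ∫ x, a i * e i x * (a j * e j x) ∂μ
      = a i * a j * ∫ x, e i x * e j x ∂μ := fun i j => by
    rw [← integral_const_mul]
    exact integral_congr_ae (Filter.Eventually.of_forall fun x => mul_mul_mul_comm _ _ _ _)
  refine Finset.sum_congr rfl fun i hi => ?_
  rw [integral_finsetSum _ fun j _ => hint i j, Finset.sum_eq_single_of_mem i hi]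
  · rw [hmul, h1, mul_one]
  · intro j _ hj
    rw [hmul, h0 i j hj.symm, mul_zero]

namespace DyadicRectangle

lemma measurableSet_toSet (R : DyadicRectangle) : MeasurableSet R.toSet :=
  R.1.measurableSet_toSet.prod R.2.measurableSet_toSet

lemma area_pos (R : DyadicRectangle) : 0 < R.area := mul_pos R.1.length_pos R.2.length_pos

lemma volume_toSet (R : DyadicRectangle) : volume R.toSet = ENNReal.ofReal R.area := by
  rw [toSet, Measure.volume_eq_prod, Measure.prod_prod, DyadicInterval.volume_toSet,
    DyadicInterval.volume_toSet, area, ENNReal.ofReal_mul R.1.length_pos.le]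

lemma volume_toSet_ne_top (R : DyadicRectangle) : volume R.toSet ≠ ∞ := by
  simp [volume_toSet]

lemma toSet_nonempty (R : DyadicRectangle) : R.toSet.Nonempty :=
  R.1.toSet_nonempty.prod R.2.toSet_nonempty

/-- The indicator function of a dyadic rectangle. -/
noncomputable def ind (R : DyadicRectangle) (x : ℝ × ℝ) : ℝ := R.1.ind x.1 * R.2.ind x.2

lemma ind_eq (R : DyadicRectangle) (x : ℝ × ℝ) :
    R.ind x = R.toSet.indicator (fun _ => (1 : ℝ)) x := by
  by_cases h1 : x.1 ∈ R.1.toSet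
  · by_cases h2 : x.2 ∈ R.2.toSet
    · rw [Set.indicator_of_mem (show x ∈ R.toSet from ⟨h1, h2⟩), ind, ind_of_mem h1,
        ind_of_mem h2, one_mul]
    · rw [Set.indicator_of_notMem (fun h => h2 h.2), ind, ind_of_notMem h2, mul_zero]
  · rw [Set.indicator_of_notMem (fun h => h1 h.1), ind, ind_of_notMem h1, zero_mul]

end DyadicRectangle

/-- A tensor product of square integrable functions is square integrable. -/
lemma memLp_tensor {φ ψ : ℝ → ℝ} (hφ : MemLp φ 2 volume) (hψ : MemLp ψ 2 volume) :
    MemLp (fun x : ℝ × ℝ => φ x.1 * ψ x.2) 2 volume := by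
  have hm : AEStronglyMeasurable (fun x : ℝ × ℝ => φ x.1 * ψ x.2) volume :=
    hφ.1.comp_fst.mul hψ.1.comp_snd
  rw [memLp_two_iff_integrable_sq hm]
  simp only [mul_pow]
  exact hφ.integrable_sq.mul_prod hψ.integrable_sq

lemma integral_tensor_mul_tensor (φ ψ φ' ψ' : ℝ → ℝ) :
    ∫ x : ℝ × ℝ, (φ x.1 * ψ x.2) * (φ' x.1 * ψ' x.2)
      = (∫ x, φ x * φ' x) * ∫ x, ψ x * ψ' x := by
  refine Eq.trans ?_ (integral_prod_mul (fun x => φ x * φ' x) (fun x => ψ x * ψ' x))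
  exact integral_congr_ae (Filter.Eventually.of_forall fun x => mul_mul_mul_comm _ _ _ _)

namespace DyadicRectangle

lemma memLp_haar (R : DyadicRectangle) : MemLp R.haar 2 volume :=
  memLp_tensor R.1.memLp_haar R.2.memLp_haar

lemma memLp_ind (R : DyadicRectangle) : MemLp R.ind 2 volume :=
  memLp_tensor R.1.memLp_ind R.2.memLp_ind

lemma integral_haar_mul_self (R : DyadicRectangle) : ∫ x, R.haar x * R.haar x = 1 := by
  simp only [haar]
  rw [integral_tensor_mul_tensor, DyadicInterval.integral_haar_mul_self,
    DyadicInterval.integral_haar_mul_self, one_mul]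

lemma integral_haar_mul_haar (R S : DyadicRectangle) (h : R ≠ S) :
    ∫ x, R.haar x * S.haar x = 0 := by
  simp only [haar]
  rw [integral_tensor_mul_tensor]
  by_cases h1 : R.1 = S.1
  · have h2 : R.2 ≠ S.2 := fun h2 => h (Prod.ext h1 h2)
    rw [DyadicInterval.integral_haar_mul_haar h2, mul_zero]
  · rw [DyadicInterval.integral_haar_mul_haar h1, zero_mul]

end DyadicRectangle

/-- The Haar function of a rectangle as an element of `L²`. -/
noncomputable def haarLp (R : DyadicRectangle) : Lp ℝ 2 (volume : Measure (ℝ × ℝ)) :=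
  R.memLp_haar.toLp _

lemma inner_toLp_toLp {α : Type*} [MeasurableSpace α] {μ : Measure α} {f g : α → ℝ}
    (hf : MemLp f 2 μ) (hg : MemLp g 2 μ) :
    inner ℝ (hf.toLp f) (hg.toLp g) = ∫ x, g x * f x ∂μ := by
  rw [L2.inner_def]
  refine integral_congr_ae ?_
  filter_upwards [hf.coeFn_toLp, hg.coeFn_toLp] with x h1 h2
  rw [h1, h2]
  simp

lemma orthonormal_haarLp : Orthonormal ℝ haarLp := by
  classical
  rw [orthonormal_iff_ite]
  intro R S
  rw [haarLp, haarLp, inner_toLp_toLp]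
  split_ifs with h
  · rw [h, DyadicRectangle.integral_haar_mul_self]
  · exact DyadicRectangle.integral_haar_mul_haar _ _ fun h' => h h'.symm

lemma norm_toLp_sq {f : ℝ × ℝ → ℝ} (hf : MemLp f 2 volume) :
    ‖hf.toLp f‖ ^ 2 = ∫ x, f x ^ 2 := by
  rw [← real_inner_self_eq_norm_sq, inner_toLp_toLp]
  simp only [pow_two]

lemma inner_haarLp {f : ℝ × ℝ → ℝ} (hf : MemLp f 2 volume) (R : DyadicRectangle) :
    inner ℝ (haarLp R) (hf.toLp f) = haarCoeff f R :=
  inner_toLp_toLp _ _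

/-- Bessel's inequality. -/
lemma sum_haarCoeff_sq_le {f : ℝ × ℝ → ℝ} (hf : MemLp f 2 volume) (s : Finset DyadicRectangle) :
    ∑ R ∈ s, haarCoeff f R ^ 2 ≤ ∫ x, f x ^ 2 := by
  have h := orthonormal_haarLp.sum_inner_products_le (x := hf.toLp f) (s := s)
  simp only [inner_haarLp, norm_toLp_sq, Real.norm_eq_abs, sq_abs] at h
  exact h

/-! ### Parseval for combinations of indicators -/

/-- The closed linear span of the Haar functions. -/
noncomputable def haarSpan : Submodule ℝ (Lp ℝ 2 (volume : Measure (ℝ × ℝ))) :=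
  (Submodule.span ℝ (Set.range haarLp)).topologicalClosure

/-- Completing the square: for `w = ∑ l_i e_i`, `‖v - w‖²` equals `‖v‖² - ∑ ⟨e_i, v⟩² + ∑ (⟨e_i, v⟩
- l_i)²`, sums over the support of `l`. Hence `‖v‖² ≤ c + ‖v - w‖²`, a closed condition on `w`,
which may be taken to the limit `w = v`. -/
lemma norm_sq_le_of_mem_closure_span {E ι : Type*} [NormedAddCommGroup E]
    [InnerProductSpace ℝ E] {e : ι → E} (he : Orthonormal ℝ e) {v : E}
    (hv : v ∈ (Submodule.span ℝ (Set.range e)).topologicalClosure) {c : ℝ}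
    (hc : ∀ s : Finset ι, ∑ i ∈ s, inner ℝ (e i) v ^ 2 ≤ c) : ‖v‖ ^ 2 ≤ c := by
  have key : ∀ w ∈ Submodule.span ℝ (Set.range e), ‖v‖ ^ 2 ≤ c + ‖v - w‖ ^ 2 := by
    intro w hw
    obtain ⟨l, rfl⟩ := (Finsupp.mem_span_range_iff_exists_finsupp).mp hw
    have h1 : ‖l.sum fun i a => a • e i‖ ^ 2 = ∑ i ∈ l.support, l i ^ 2 := by
      rw [← real_inner_self_eq_norm_sq, Finsupp.sum, he.inner_sum]
      simp [pow_two]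
    have h2 : inner ℝ v (l.sum fun i a => a • e i)
        = ∑ i ∈ l.support, l i * inner ℝ (e i) v := by
      rw [Finsupp.sum, inner_sum]
      refine Finset.sum_congr rfl fun i _ => ?_
      rw [inner_smul_right, real_inner_comm]
    rw [norm_sub_sq_real, h1, h2]
    have h3 := hc l.support
    have h4 : 0 ≤ ∑ i ∈ l.support, (inner ℝ (e i) v - l i) ^ 2 :=
      Finset.sum_nonneg fun i _ => sq_nonneg _
    have h5 : ∑ i ∈ l.support, (inner ℝ (e i) v - l i) ^ 2
        = ∑ i ∈ l.support, inner ℝ (e i) v ^ 2 - 2 * ∑ i ∈ l.support, l i * inner ℝ (e i) v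
          + ∑ i ∈ l.support, l i ^ 2 := by
      rw [Finset.mul_sum, ← Finset.sum_sub_distrib, ← Finset.sum_add_distrib]
      exact Finset.sum_congr rfl fun i _ => by ring
    linarith
  have hclosed : IsClosed {w : E | ‖v‖ ^ 2 ≤ c + ‖v - w‖ ^ 2} :=
    isClosed_le (by fun_prop) (by fun_prop)
  have : ‖v‖ ^ 2 ≤ c + ‖v - v‖ ^ 2 :=
    closure_minimal (s := (Submodule.span ℝ (Set.range e) : Set E)) key hclosed hv
  simpa using this

lemma integral_sq_le_of_mem_haarSpan {f : ℝ × ℝ → ℝ} (hf : MemLp f 2 volume)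
    (hv : hf.toLp f ∈ haarSpan) {c : ℝ}
    (hc : ∀ s : Finset DyadicRectangle, ∑ R ∈ s, haarCoeff f R ^ 2 ≤ c) :
    ∫ x, f x ^ 2 ≤ c := by
  rw [← norm_toLp_sq hf]
  refine norm_sq_le_of_mem_closure_span orthonormal_haarLp hv fun s => ?_
  simp only [inner_haarLp]
  exact hc s

/-- Telescoping gives `z 0 - 2⁻ᵐ z m ∈ V`, and `‖2⁻ᵐ z m‖² ≤ C 2⁻ᵐ` tends to zero. The intended `z
m` has a factor `χ` of the `m`-th ancestor: its squared norm doubles at each step, while `χ_I`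
differs from half the indicator of its parent by a multiple of one Haar function. -/
lemma mem_of_sub_half_mem {E : Type*} [NormedAddCommGroup E] [NormedSpace ℝ E]
    {V : Submodule ℝ E} (hV : IsClosed (V : Set E)) {z : ℕ → E} {C : ℝ}
    (hz : ∀ m, z m - (2⁻¹ : ℝ) • z (m + 1) ∈ V) (hC : ∀ m, ‖z m‖ ^ 2 ≤ C * 2 ^ m) : z 0 ∈ V := by
  have h1 : ∀ m : ℕ, z 0 - ((2⁻¹ : ℝ) ^ m) • z m ∈ V := by
    intro m
    induction m with
    | zero => simp
    | succ m ih =>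
      have := V.add_mem ih (V.smul_mem ((2⁻¹ : ℝ) ^ m) (hz m))
      rw [smul_sub, smul_smul, ← pow_succ] at this
      simpa using this
  have hlim : Filter.Tendsto (fun m : ℕ => ((2⁻¹ : ℝ) ^ m) • z m) Filter.atTop (nhds 0) := by
    rw [tendsto_zero_iff_norm_tendsto_zero]
    have h2 : Filter.Tendsto (fun m : ℕ => ‖((2⁻¹ : ℝ) ^ m) • z m‖ ^ 2) Filter.atTop (nhds 0) := by
      have h3 : Filter.Tendsto (fun m : ℕ => C * (2⁻¹ : ℝ) ^ m) Filter.atTop (nhds 0) := by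
        simpa using (tendsto_pow_atTop_nhds_zero_of_lt_one (r := (2⁻¹ : ℝ)) (by norm_num)
          (by norm_num)).const_mul C
      refine squeeze_zero (fun _ => sq_nonneg _) (fun m => ?_) h3
      rw [norm_smul, mul_pow, norm_pow, Real.norm_of_nonneg (by norm_num : (0 : ℝ) ≤ 2⁻¹)]
      calc ((2⁻¹ : ℝ) ^ m) ^ 2 * ‖z m‖ ^ 2 ≤ ((2⁻¹ : ℝ) ^ m) ^ 2 * (C * 2 ^ m) := by
            gcongr
            exact hC m
        _ = C * (2⁻¹ : ℝ) ^ m * ((2⁻¹ : ℝ) ^ m * 2 ^ m) := by ring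
        _ = C * (2⁻¹ : ℝ) ^ m := by rw [← mul_pow]; simp
    have h4 := h2.sqrt
    simpa [Real.sqrt_sq_eq_abs] using h4
  have := hV.mem_of_tendsto (tendsto_const_nhds.sub hlim)
    (Filter.Eventually.of_forall fun m => h1 m)
  simpa using this

lemma isClosed_haarSpan : IsClosed (haarSpan : Set (Lp ℝ 2 (volume : Measure (ℝ × ℝ)))) :=
  Submodule.isClosed_topologicalClosure _

lemma integral_iterate_parent (I : DyadicInterval) (m : ℕ) :
    ∫ x, (parent^[m] I).ind x ^ 2 = I.length * 2 ^ m := by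
  have h : ∀ x, (parent^[m] I).ind x ^ 2 = (parent^[m] I).ind x := by
    intro x
    by_cases hx : x ∈ (parent^[m] I).toSet
    · rw [ind_of_mem hx, one_pow]
    · rw [ind_of_notMem hx]
      simp
  simp only [h]
  rw [integral_ind]
  induction m with
  | zero => simp
  | succ m ih =>
    rw [Function.iterate_succ_apply', length_parent, ih fun x => ?_, pow_succ]
    · ring
    · by_cases hx : x ∈ (parent^[m] I).toSet
      · rw [ind_of_mem hx, one_pow]
      · rw [ind_of_notMem hx]
        simp

/-- Tensors `h_I ⊗ χ_J` lie in the closed span of the Haar functions. -/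
lemma toLp_haar_ind_mem (I J : DyadicInterval) :
    (memLp_tensor I.memLp_haar J.memLp_ind).toLp _ ∈ haarSpan := by
  let z : ℕ → Lp ℝ 2 (volume : Measure (ℝ × ℝ)) := fun m =>
    (memLp_tensor I.memLp_haar (parent^[m] J).memLp_ind).toLp _
  refine mem_of_sub_half_mem isClosed_haarSpan (z := z) (C := J.length) (fun m => ?_) fun m => ?_
  · obtain ⟨c, hc⟩ := (parent^[m] J).exists_ind_eq
    have : z m - (2⁻¹ : ℝ) • z (m + 1) = c • haarLp (I, parent^[m + 1] J) := by
      simp only [z, haarLp]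
      rw [← MemLp.toLp_const_smul, ← MemLp.toLp_const_smul, ← MemLp.toLp_sub]
      refine MemLp.toLp_congr _ _ (Filter.Eventually.of_forall fun x => ?_)
      simp only [Pi.sub_apply, Pi.smul_apply, smul_eq_mul, DyadicRectangle.haar,
        Function.iterate_succ_apply', hc]
      ring
    rw [this]
    exact Submodule.smul_mem _ _ (subset_closure (Submodule.subset_span ⟨_, rfl⟩))
  · simp only [z]
    rw [norm_toLp_sq]
    simp only [pow_two]
    rw [integral_tensor_mul_tensor, DyadicInterval.integral_haar_mul_self, one_mul]
    simp only [← pow_two]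
    exact (integral_iterate_parent J m).le

/-- Indicator functions of dyadic rectangles lie in the closed span of the Haar functions. -/
lemma toLp_ind_mem (R : DyadicRectangle) : R.memLp_ind.toLp _ ∈ haarSpan := by
  obtain ⟨I, J⟩ := R
  let z : ℕ → Lp ℝ 2 (volume : Measure (ℝ × ℝ)) := fun m =>
    (memLp_tensor (parent^[m] I).memLp_ind J.memLp_ind).toLp _
  refine mem_of_sub_half_mem isClosed_haarSpan (z := z) (C := I.length * J.length)
    (fun m => ?_) fun m => ?_
  · obtain ⟨c, hc⟩ := (parent^[m] I).exists_ind_eq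
    have : z m - (2⁻¹ : ℝ) • z (m + 1)
        = c • (memLp_tensor (parent^[m + 1] I).memLp_haar J.memLp_ind).toLp _ := by
      simp only [z]
      rw [← MemLp.toLp_const_smul, ← MemLp.toLp_const_smul, ← MemLp.toLp_sub]
      refine MemLp.toLp_congr _ _ (Filter.Eventually.of_forall fun x => ?_)
      simp only [Pi.sub_apply, Pi.smul_apply, smul_eq_mul, Function.iterate_succ_apply', hc]
      ring
    rw [this]
    exact Submodule.smul_mem _ _ (toLp_haar_ind_mem _ _)
  · simp only [z]
    rw [norm_toLp_sq]
    simp only [pow_two]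
    rw [integral_tensor_mul_tensor]
    simp only [← pow_two]
    rw [integral_iterate_parent, show J = parent^[0] J from rfl, integral_iterate_parent]
    simp only [Function.iterate_zero, id]
    apply le_of_eq
    ring

/-- A finite linear combination of indicators of dyadic rectangles satisfies Parseval. -/
lemma integral_sq_le_of_sum_haarCoeff_sq_le (s : Finset DyadicRectangle) (a : DyadicRectangle → ℝ)
    {c : ℝ} (hc : ∀ t : Finset DyadicRectangle,
      ∑ R ∈ t, haarCoeff (fun x => ∑ S ∈ s, a S * S.ind x) R ^ 2 ≤ c) :
    ∫ x, (∑ S ∈ s, a S * S.ind x) ^ 2 ≤ c := by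
  have hf : MemLp (fun x => ∑ S ∈ s, a S * S.ind x) 2 volume :=
    memLp_finsetSum _ fun S _ => S.memLp_ind.const_mul _
  refine integral_sq_le_of_mem_haarSpan hf ?_ hc
  have : hf.toLp _ = ∑ S ∈ s, a S • (S.memLp_ind.toLp _) := by
    clear hc
    induction s using Finset.cons_induction with
    | empty => simp only [Finset.sum_empty]; rfl
    | cons R s hR ih =>
      simp only [Finset.sum_cons]
      rw [← ih (memLp_finsetSum _ fun S _ => S.memLp_ind.const_mul _),
        ← MemLp.toLp_const_smul, ← MemLp.toLp_add]
      rfl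
  rw [this]
  exact Submodule.sum_mem _ fun S _ => Submodule.smul_mem _ _ (toLp_ind_mem S)

/-! ### The `BMO` norm and Carleson families -/

section Norm

variable {f : DyadicDistribution}

lemma tsum_sq_le_of_isOpen {Ω : Set (ℝ × ℝ)} (ho : IsOpen Ω) (hne : Ω.Nonempty)
    (hfin : volume Ω < ∞) :
    ∑' R : {R : DyadicRectangle // R.toSet ⊆ Ω}, ENNReal.ofReal (f R.1 ^ 2)
      ≤ bmoNorm f ^ 2 * volume Ω := by
  have h : ((volume Ω)⁻¹ *
      ∑' R : {R : DyadicRectangle // DyadicRectangle.toSet R ⊆ Ω},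
        ENNReal.ofReal (f R.1 ^ 2)) ^ (1 / 2 : ℝ) ≤ bmoNorm f :=
    le_iSup₂_of_le Ω ho (le_iSup₂_of_le hne hfin le_rfl)
  rw [one_div, ENNReal.rpow_inv_le_iff two_pos, ENNReal.rpow_two,
    ENNReal.inv_mul_le_iff (ho.measure_pos volume hne).ne' hfin.ne] at h
  rwa [mul_comm]

/-- Finite sums of squares over rectangles inside an arbitrary set are controlled by the norm. -/
lemma sum_sq_le (hf : bmoNorm f ≠ ∞) {G : Set (ℝ × ℝ)} (hG : volume G ≠ ∞)
    {s : Finset DyadicRectangle} (hs : ∀ R ∈ s, R.toSet ⊆ G) :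
    ∑ R ∈ s, ENNReal.ofReal (f R ^ 2) ≤ bmoNorm f ^ 2 * volume G := by
  classical
  rcases s.eq_empty_or_nonempty with rfl | ⟨R₀, hR₀⟩
  · simp
  have key : ∀ O : Set (ℝ × ℝ), G ⊆ O → IsOpen O → volume O ≠ ∞ →
      ∑ R ∈ s, ENNReal.ofReal (f R ^ 2) ≤ bmoNorm f ^ 2 * volume O := by
    intro O hGO hO hfin
    have hne : O.Nonempty := R₀.toSet_nonempty.mono ((hs _ hR₀).trans hGO)
    refine le_trans ?_ (tsum_sq_le_of_isOpen hO hne hfin.lt_top)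
    have h1 := ENNReal.sum_le_tsum (f := fun R : {R : DyadicRectangle // R.toSet ⊆ O} =>
      ENNReal.ofReal (f R.1 ^ 2)) (s.subtype _)
    rwa [Finset.sum_subtype_of_mem (fun R => ENNReal.ofReal (f R ^ 2))
      fun R hR => (hs R hR).trans hGO] at h1
  -- Unions of half-open rectangles are not open, so the bound is transferred by outer regularity.
  -- One open superset of finite area suffices when the norm is zero; otherwise dividing by the
  -- squared norm allows passing to the infimum.
  obtain ⟨O₁, hGO₁, hO₁, hO₁'⟩ := G.exists_isOpen_lt_of_lt _ hG.lt_top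
  rcases eq_or_ne (bmoNorm f) 0 with h0 | h0
  · simpa [h0] using key O₁ hGO₁ hO₁ hO₁'.ne
  have h2 : bmoNorm f ^ 2 ≠ 0 := pow_ne_zero _ h0
  have h3 : bmoNorm f ^ 2 ≠ ∞ := ENNReal.pow_ne_top hf
  rw [mul_comm, ← ENNReal.div_le_iff_le_mul (Or.inl h2) (Or.inl h3), G.measure_eq_iInf_isOpen]
  refine le_iInf₂ fun O hGO => le_iInf fun hO => ?_
  rw [ENNReal.div_le_iff_le_mul (Or.inl h2) (Or.inl h3), mul_comm]
  rcases eq_or_ne (volume O) ∞ with h | h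
  · rw [h, ENNReal.mul_top h2]
    exact le_top
  · exact key O hGO hO h

lemma bmoNorm_le {N : ℝ≥0∞} (h : ∀ Ω : Set (ℝ × ℝ), IsOpen Ω → Ω.Nonempty → volume Ω < ∞ →
    ∀ s : Finset DyadicRectangle, (∀ R ∈ s, R.toSet ⊆ Ω) →
      ∑ R ∈ s, ENNReal.ofReal (f R ^ 2) ≤ N ^ 2 * volume Ω) : bmoNorm f ≤ N := by
  refine iSup₂_le fun Ω ho => iSup₂_le fun hne hfin => ?_
  rw [one_div, ENNReal.rpow_inv_le_iff two_pos, ENNReal.rpow_two,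
    ENNReal.inv_mul_le_iff (ho.measure_pos volume hne).ne' hfin.ne, ENNReal.tsum_eq_iSup_sum]
  refine iSup_le fun s => ?_
  have h1 := h Ω ho hne hfin (s.map (Function.Embedding.subtype _)) (by
    simp only [Finset.mem_map, Function.Embedding.subtype_apply]
    rintro _ ⟨R, -, rfl⟩
    exact R.2)
  rw [Finset.sum_map] at h1
  rwa [mul_comm]

/-- Products of two `BMO` families form a Carleson family. -/
lemma sum_abs_mul_le {g : DyadicDistribution} (hf : bmoNorm f ≠ ∞) (hg : bmoNorm g ≠ ∞)
    (s : Finset DyadicRectangle) :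
    ∑ R ∈ s, ENNReal.ofReal |f R * g R|
      ≤ bmoNorm f * bmoNorm g * volume (⋃ R ∈ s, R.toSet) := by
  have hfin : volume (⋃ R ∈ s, R.toSet) ≠ ∞ :=
    ((measure_biUnion_finset_le _ _).trans_lt
      (ENNReal.sum_lt_top.mpr fun R _ => R.volume_toSet_ne_top.lt_top)).ne
  have hsub : ∀ R ∈ s, R.toSet ⊆ ⋃ R ∈ s, R.toSet := fun R hR =>
    Set.subset_biUnion_of_mem (u := DyadicRectangle.toSet) hR
  have hsq : ∀ h : DyadicDistribution, ∀ R, ENNReal.ofReal |h R| ^ (2 : ℝ)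
      = ENNReal.ofReal (h R ^ 2) := fun h R => by
    rw [ENNReal.rpow_two, ← ENNReal.ofReal_pow (abs_nonneg _), sq_abs]
  calc ∑ R ∈ s, ENNReal.ofReal |f R * g R|
      = ∑ R ∈ s, ENNReal.ofReal |f R| * ENNReal.ofReal |g R| := by
        simp only [abs_mul, ENNReal.ofReal_mul (abs_nonneg _)]
    _ ≤ (∑ R ∈ s, ENNReal.ofReal |f R| ^ (2 : ℝ)) ^ (1 / 2 : ℝ)
        * (∑ R ∈ s, ENNReal.ofReal |g R| ^ (2 : ℝ)) ^ (1 / 2 : ℝ) :=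
        ENNReal.inner_le_Lp_mul_Lq s _ _ Real.HolderConjugate.two_two
    _ ≤ (bmoNorm f ^ 2 * volume (⋃ R ∈ s, R.toSet)) ^ (1 / 2 : ℝ)
        * (bmoNorm g ^ 2 * volume (⋃ R ∈ s, R.toSet)) ^ (1 / 2 : ℝ) := by
        simp only [hsq]
        gcongr
        · exact sum_sq_le hf hfin hsub
        · exact sum_sq_le hg hfin hsub
    _ = bmoNorm f * bmoNorm g * volume (⋃ R ∈ s, R.toSet) := by
        have h2 : ∀ a : ℝ≥0∞, (a ^ 2) ^ (1 / 2 : ℝ) = a := fun a => by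
          rw [← ENNReal.rpow_two, ← ENNReal.rpow_mul]
          norm_num
        rw [← ENNReal.mul_rpow_of_nonneg _ _ (by norm_num : (0 : ℝ) ≤ 1 / 2)]
        conv_rhs => rw [← h2 (bmoNorm f * bmoNorm g * volume (⋃ R ∈ s, R.toSet))]
        congr 1
        ring

end Norm

/-! ### Layer cake formulas and the Carleson embedding -/

section LayerCake

lemma volume_Ioi_inter_lt (a : ℝ≥0∞) :
    volume {t : ℝ | t ∈ Set.Ioi 0 ∧ ENNReal.ofReal t < a} = a := by
  rcases eq_or_ne a ∞ with rfl | ha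
  · have : {t : ℝ | t ∈ Set.Ioi 0 ∧ ENNReal.ofReal t < ∞} = Set.Ioi 0 := by
      ext t
      simp
    rw [this, Real.volume_Ioi]
  lift a to ℝ≥0 using ha
  have : {t : ℝ | t ∈ Set.Ioi 0 ∧ ENNReal.ofReal t < a} = Set.Ioo 0 (a : ℝ) := by
    ext t
    simp only [Set.mem_ofPred_eq, Set.mem_Ioi, Set.mem_Ioo]
    refine and_congr_right fun ht => ?_
    rw [← ENNReal.ofReal_coe_nnreal, ENNReal.ofReal_lt_ofReal_iff_of_nonneg ht.le]
  rw [this, Real.volume_Ioo, sub_zero, ENNReal.ofReal_coe_nnreal]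

lemma lintegral_below (a : ℝ≥0∞) : ∫⁻ t in Set.Ioi (0 : ℝ),
    (if ENNReal.ofReal t < a then 1 else 0) = a := by
  have hm : MeasurableSet {t : ℝ | ENNReal.ofReal t < a} :=
    measurableSet_lt ENNReal.measurable_ofReal measurable_const
  have := lintegral_indicator_one (μ := volume.restrict (Set.Ioi (0 : ℝ))) hm
  rw [Measure.restrict_apply hm] at this
  refine Eq.trans ?_ (this.trans ?_)
  · refine lintegral_congr fun t => ?_
    simp [Set.indicator_apply]
  · refine Eq.trans ?_ (volume_Ioi_inter_lt a)
    rw [Set.inter_comm]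
    rfl

/-- This is `b² = ∫₀ᵇ 2t dt` for finite `b ≤ a`; for `a = ∞` the values `b = r + 1` are unbounded.
-/
lemma sq_le_lintegral (a : ℝ≥0∞) : a ^ 2 ≤ ∫⁻ t in Set.Ioi (0 : ℝ),
    ENNReal.ofReal (2 * t) * (if ENNReal.ofReal t < a then 1 else 0) := by
  have key : ∀ b : ℝ≥0, (b : ℝ≥0∞) ≤ a → (b : ℝ≥0∞) ^ 2 ≤ ∫⁻ t in Set.Ioi (0 : ℝ),
      ENNReal.ofReal (2 * t) * (if ENNReal.ofReal t < a then 1 else 0) := by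
    intro b hb
    calc (b : ℝ≥0∞) ^ 2 = ENNReal.ofReal (∫ t in (0 : ℝ)..b, 2 * t) := by
          rw [intervalIntegral.integral_const_mul, integral_id]
          rw [← ENNReal.ofReal_coe_nnreal, ← ENNReal.ofReal_pow b.coe_nonneg]
          congr 1
          ring
      _ = ∫⁻ t in Set.Ioo (0 : ℝ) b, ENNReal.ofReal (2 * t) := by
          rw [intervalIntegral.integral_of_le b.coe_nonneg, integral_Ioc_eq_integral_Ioo]
          refine ofReal_integral_eq_lintegral_ofReal ?_ ?_
          · exact (Continuous.integrableOn_Icc (by fun_prop)).mono_set Set.Ioo_subset_Icc_self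
          · filter_upwards [ae_restrict_mem measurableSet_Ioo] with t ht
            simpa using ht.1.le
      _ = ∫⁻ t in Set.Ioo (0 : ℝ) b,
            ENNReal.ofReal (2 * t) * (if ENNReal.ofReal t < a then 1 else 0) := by
          refine setLIntegral_congr_fun measurableSet_Ioo fun t ht => ?_
          have : ENNReal.ofReal t < a := lt_of_lt_of_le
            (by rw [← ENNReal.ofReal_coe_nnreal,
              ENNReal.ofReal_lt_ofReal_iff_of_nonneg ht.1.le]; exact ht.2) hb
          simp [this]
      _ ≤ _ := lintegral_mono_set fun t ht => ht.1
  rcases eq_or_ne a ∞ with rfl | ha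
  · rw [ENNReal.top_pow two_ne_zero, top_le_iff]
    refine ENNReal.eq_top_of_forall_nnreal_le fun r => le_trans ?_ (key (r + 1) le_top)
    norm_cast
    nlinarith [r.2, sq_nonneg r]
  · lift a to ℝ≥0 using ha
    exact key a le_rfl

lemma measurable_ite_lt {α : Type*} [MeasurableSpace α] {φ : α → ℝ≥0∞} (hφ : Measurable φ) :
    Measurable fun p : α × ℝ => if ENNReal.ofReal p.2 < φ p.1 then (1 : ℝ≥0∞) else 0 :=
  Measurable.ite (measurableSet_lt (by fun_prop) (by fun_prop)) measurable_const measurable_const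

/-- The Carleson embedding inequality: a Carleson family tested against values `m R` is bounded
by the integral of any majorant of `∑ R, m R χ_R`. -/
lemma carleson_embedding {s : Finset DyadicRectangle} {β m : DyadicRectangle → ℝ≥0∞} {A : ℝ≥0∞}
    (hA : ∀ t ⊆ s, ∑ R ∈ t, β R ≤ A * volume (⋃ R ∈ t, R.toSet)) {W : ℝ × ℝ → ℝ≥0∞}
    (hW : Measurable W) (hm : ∀ R ∈ s, ∀ x ∈ R.toSet, m R ≤ W x) :
    ∑ R ∈ s, β R * m R ≤ A * ∫⁻ x in ⋃ R ∈ s, R.toSet, W x := by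
  classical
  have hms : ∀ R : DyadicRectangle, Measurable fun t : ℝ =>
      β R * (if ENNReal.ofReal t < m R then (1 : ℝ≥0∞) else 0) := fun R =>
    (Measurable.ite (measurableSet_lt ENNReal.measurable_ofReal measurable_const)
      measurable_const measurable_const).const_mul _
  calc ∑ R ∈ s, β R * m R
      = ∫⁻ t in Set.Ioi (0 : ℝ), ∑ R ∈ s,
          β R * (if ENNReal.ofReal t < m R then 1 else 0) := by
        rw [lintegral_finsetSum _ fun R _ => hms R]
        refine Finset.sum_congr rfl fun R _ => ?_
        rw [lintegral_const_mul _ (Measurable.ite (measurableSet_lt ENNReal.measurable_ofReal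
          measurable_const) measurable_const measurable_const), lintegral_below]
    _ ≤ ∫⁻ t in Set.Ioi (0 : ℝ), A * ∫⁻ x in ⋃ R ∈ s, R.toSet,
          (if ENNReal.ofReal t < W x then 1 else 0) := by
        -- At each level `t` the Carleson condition is applied to the rectangles with `m R > t`;
        -- their union lies in `{W > t}`.
        refine lintegral_mono fun t => ?_
        have h1 := hA (s.filter fun R => ENNReal.ofReal t < m R) (Finset.filter_subset _ _)
        have h2 : ∑ R ∈ s, β R * (if ENNReal.ofReal t < m R then (1 : ℝ≥0∞) else 0)
            = ∑ R ∈ s.filter fun R => ENNReal.ofReal t < m R, β R := by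
          rw [Finset.sum_filter]
          exact Finset.sum_congr rfl fun R _ => by split_ifs <;> simp
        refine (h2.trans_le h1).trans ?_
        gcongr
        have hS : MeasurableSet {x | ENNReal.ofReal t < W x} :=
          measurableSet_lt measurable_const hW
        have h3 := lintegral_indicator_one (μ := volume.restrict (⋃ R ∈ s, R.toSet)) hS
        rw [Measure.restrict_apply hS] at h3
        have h4 : ∫⁻ x in ⋃ R ∈ s, R.toSet, (if ENNReal.ofReal t < W x then (1 : ℝ≥0∞) else 0)
            = volume ({x | ENNReal.ofReal t < W x} ∩ ⋃ R ∈ s, R.toSet) := by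
          rw [← h3]
          congr 1
          funext x
          simp [Set.indicator_apply]
        rw [h4]
        refine measure_mono fun x hx => ?_
        simp only [Set.mem_iUnion, Finset.mem_filter, exists_prop] at hx
        obtain ⟨R, ⟨hR, hlt⟩, hx⟩ := hx
        exact ⟨hlt.trans_le (hm R hR x hx), Set.mem_biUnion (s := (s : Set DyadicRectangle)) hR hx⟩
    _ = A * ∫⁻ x in ⋃ R ∈ s, R.toSet, W x := by
        have hmeas := measurable_ite_lt hW
        have hmeas' : Measurable fun t : ℝ => ∫⁻ x in ⋃ R ∈ s, R.toSet,
            (if ENNReal.ofReal t < W x then (1 : ℝ≥0∞) else 0) := hmeas.lintegral_prod_left'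
        rw [lintegral_const_mul _ hmeas', lintegral_lintegral_swap]
        · simp only [lintegral_below]
        · exact (hmeas.comp measurable_swap).aemeasurable

end LayerCake

/-! ### Dyadic maximal functions on `L²` -/

section Maximal

/-- The dyadic maximal function on the line. -/
noncomputable def maxFun (w : ℝ → ℝ≥0∞) (x : ℝ) : ℝ≥0∞ :=
  ⨆ K : DyadicInterval, K.toSet.indicator (fun _ => (volume K.toSet)⁻¹ * ∫⁻ t in K.toSet, w t) x

lemma measurable_maxFun (w : ℝ → ℝ≥0∞) : Measurable (maxFun w) :=
  Measurable.iSup fun K => measurable_const.indicator K.measurableSet_toSet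

lemma le_maxFun (w : ℝ → ℝ≥0∞) {K : DyadicInterval} {x : ℝ} (hx : x ∈ K.toSet) :
    (volume K.toSet)⁻¹ * ∫⁻ t in K.toSet, w t ≤ maxFun w x := by
  refine le_iSup_of_le K ?_
  rw [Set.indicator_of_mem hx]

/-- The weak type estimate in which only the large values of the function enter. -/
lemma mul_volume_lt_maxFun_le {w : ℝ → ℝ≥0∞} (hw : Measurable w) {T : ℝ≥0∞} (hT : T ≠ ∞) :
    T * volume {x | 2 * T < maxFun w x} ≤ ∫⁻ x, w x * (if T < w x then 1 else 0) := by
  -- Truncation: `w ≤ T + w'`, so an average of `w` above `2T` forces the average of `w'` above `T`.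
  let w' : ℝ → ℝ≥0∞ := fun x => w x * (if T < w x then 1 else 0)
  have hw' : Measurable w' := hw.mul
    (Measurable.ite (measurableSet_lt measurable_const hw) measurable_const measurable_const)
  have hww : ∀ x, w x ≤ T + w' x := fun x => by
    simp only [w']
    split_ifs with h
    · simp
    · simpa using h
  have h := volume_biUnion_dense_le (volume.withDensity w') T
  rw [withDensity_apply _ MeasurableSet.univ, Measure.restrict_univ] at h
  refine le_trans ?_ h
  gcongr
  intro x hx
  obtain ⟨K, hK⟩ := lt_iSup_iff.mp (show 2 * T < maxFun w x from hx)
  by_cases hxK : x ∈ K.toSet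
  · rw [Set.indicator_of_mem hxK] at hK
    refine Set.mem_biUnion (x := K) ?_ hxK
    change T * volume K.toSet < _
    rw [withDensity_apply _ K.measurableSet_toSet]
    have h1 : 2 * T * volume K.toSet < ∫⁻ t in K.toSet, w t := by
      rwa [← ENNReal.div_eq_inv_mul, ENNReal.lt_div_iff_mul_lt (Or.inl K.volume_toSet_ne_zero)
        (Or.inl K.volume_toSet_ne_top)] at hK
    have h2 : ∫⁻ t in K.toSet, w t ≤ T * volume K.toSet + ∫⁻ t in K.toSet, w' t := by
      calc ∫⁻ t in K.toSet, w t ≤ ∫⁻ t in K.toSet, (T + w' t) := lintegral_mono fun t => hww t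
        _ = _ := by rw [lintegral_add_left measurable_const, setLIntegral_const]
    have h3 := h1.trans_le h2
    rw [mul_assoc, two_mul] at h3
    exact (ENNReal.add_lt_add_iff_left
      (ENNReal.mul_ne_top hT K.volume_toSet_ne_top)).mp h3
  · rw [Set.indicator_of_notMem hxK] at hK
    exact absurd hK not_lt_zero

/-- The dyadic maximal function is bounded on `L²`. -/
lemma lintegral_maxFun_sq_le {w : ℝ → ℝ≥0∞} (hw : Measurable w) :
    ∫⁻ x, maxFun w x ^ 2 ≤ 8 * ∫⁻ x, w x ^ 2 := by
  have hM : Measurable fun x => maxFun w x / 2 := (measurable_maxFun w).div_const 2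
  have hif := measurable_ite_lt hM
  have hifw := measurable_ite_lt hw
  -- Halving matches the level `2T` of the weak type estimate. The constant is `8 = 4 · 2`, the 2
  -- coming from the density `2t`.
  calc ∫⁻ x, maxFun w x ^ 2 = ∫⁻ x, 4 * (maxFun w x / 2) ^ 2 := by
        congr 1
        funext x
        conv_lhs => rw [← ENNReal.mul_div_cancel (a := 2) (b := maxFun w x) (by simp) (by simp)]
        ring
    _ = 4 * ∫⁻ x, (maxFun w x / 2) ^ 2 := lintegral_const_mul _ (hM.pow_const 2)
    _ ≤ 4 * ∫⁻ x, ∫⁻ t in Set.Ioi (0 : ℝ),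
          ENNReal.ofReal (2 * t) * (if ENNReal.ofReal t < maxFun w x / 2 then 1 else 0) := by
        gcongr
        exact sq_le_lintegral _
    _ = 4 * ∫⁻ t in Set.Ioi (0 : ℝ), ∫⁻ x,
          ENNReal.ofReal (2 * t) * (if ENNReal.ofReal t < maxFun w x / 2 then 1 else 0) := by
        rw [lintegral_lintegral_swap]
        exact (Measurable.mul (by fun_prop) hif).aemeasurable
    _ ≤ 4 * ∫⁻ t in Set.Ioi (0 : ℝ), ∫⁻ x,
          2 * (w x * (if ENNReal.ofReal t < w x then 1 else 0)) := by
        gcongr 4 * ?_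
        refine lintegral_mono fun t => ?_
        have h1 := mul_volume_lt_maxFun_le hw (T := ENNReal.ofReal t) ENNReal.ofReal_ne_top
        have hS : MeasurableSet {x | 2 * ENNReal.ofReal t < maxFun w x} :=
          measurableSet_lt measurable_const (measurable_maxFun w)
        have h2 : ∀ x, (if ENNReal.ofReal t < maxFun w x / 2 then (1 : ℝ≥0∞) else 0)
            = {x | 2 * ENNReal.ofReal t < maxFun w x}.indicator 1 x := fun x => by
          rw [Set.indicator_apply]
          refine if_congr ?_ rfl rfl
          rw [ENNReal.lt_div_iff_mul_lt (by simp) (by simp), mul_comm]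
          rfl
        simp only [h2]
        have h5 : Measurable fun x => w x * (if ENNReal.ofReal t < w x then (1 : ℝ≥0∞) else 0) :=
          hw.mul (hifw.comp (measurable_id.prodMk (measurable_const (a := t))))
        rw [lintegral_const_mul _ (measurable_one.indicator hS), lintegral_indicator_one hS,
          lintegral_const_mul _ h5, ENNReal.ofReal_mul zero_le_two, mul_assoc]
        simp only [ENNReal.ofReal_ofNat]
        gcongr
    _ = 4 * ∫⁻ x, ∫⁻ t in Set.Ioi (0 : ℝ),
          2 * (w x * (if ENNReal.ofReal t < w x then 1 else 0)) := by
        rw [lintegral_lintegral_swap]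
        exact (Measurable.const_mul ((hw.comp measurable_snd).mul
          (hifw.comp measurable_swap)) 2).aemeasurable
    _ = 8 * ∫⁻ x, w x ^ 2 := by
        have h3 : ∀ x, ∫⁻ t in Set.Ioi (0 : ℝ),
            2 * (w x * (if ENNReal.ofReal t < w x then 1 else 0)) = 2 * w x ^ 2 := fun x => by
          have h4 : Measurable fun t : ℝ =>
              (if ENNReal.ofReal t < w x then (1 : ℝ≥0∞) else 0) :=
            hifw.comp (measurable_const.prodMk measurable_id)
          rw [lintegral_const_mul _ (h4.const_mul _), lintegral_const_mul _ h4, lintegral_below,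
            pow_two]
        simp only [h3]
        rw [lintegral_const_mul _ (hw.pow_const 2), ← mul_assoc]
        norm_num

/-- The dyadic maximal function in the first variable. -/
noncomputable def maxFunFst (H : ℝ × ℝ → ℝ≥0∞) (x : ℝ × ℝ) : ℝ≥0∞ :=
  maxFun (fun t => H (t, x.2)) x.1

/-- The dyadic maximal function in the second variable. -/
noncomputable def maxFunSnd (H : ℝ × ℝ → ℝ≥0∞) (x : ℝ × ℝ) : ℝ≥0∞ :=
  maxFun (fun t => H (x.1, t)) x.2

lemma measurable_maxFunFst {H : ℝ × ℝ → ℝ≥0∞} (hH : Measurable H) :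
    Measurable (maxFunFst H) := by
  refine Measurable.iSup fun K => ?_
  have h : Measurable fun x : ℝ × ℝ => (volume K.toSet)⁻¹ * ∫⁻ t in K.toSet, H (t, x.2) :=
    (hH.lintegral_prod_left'.comp measurable_snd).const_mul _
  exact h.indicator (K.measurableSet_toSet.preimage measurable_fst)

lemma measurable_maxFunSnd {H : ℝ × ℝ → ℝ≥0∞} (hH : Measurable H) :
    Measurable (maxFunSnd H) := by
  refine Measurable.iSup fun K => ?_
  have h : Measurable fun x : ℝ × ℝ => (volume K.toSet)⁻¹ * ∫⁻ t in K.toSet, H (x.1, t) :=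
    (hH.lintegral_prod_right'.comp measurable_fst).const_mul _
  exact h.indicator (K.measurableSet_toSet.preimage measurable_snd)

lemma lintegral_maxFunFst_sq_le {H : ℝ × ℝ → ℝ≥0∞} (hH : Measurable H) :
    ∫⁻ x, maxFunFst H x ^ 2 ≤ 8 * ∫⁻ x, H x ^ 2 := by
  rw [Measure.volume_eq_prod, lintegral_prod_symm' _ ((measurable_maxFunFst hH).pow_const 2),
    lintegral_prod_symm' _ (hH.pow_const 2),
    ← lintegral_const_mul _ (hH.pow_const 2).lintegral_prod_left']
  exact lintegral_mono fun y => lintegral_maxFun_sq_le (hH.comp measurable_prodMk_right)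

lemma lintegral_maxFunSnd_sq_le {H : ℝ × ℝ → ℝ≥0∞} (hH : Measurable H) :
    ∫⁻ x, maxFunSnd H x ^ 2 ≤ 8 * ∫⁻ x, H x ^ 2 := by
  rw [Measure.volume_eq_prod, lintegral_prod _ ((measurable_maxFunSnd hH).pow_const 2).aemeasurable,
    lintegral_prod _ (hH.pow_const 2).aemeasurable,
    ← lintegral_const_mul _ (hH.pow_const 2).lintegral_prod_right']
  exact lintegral_mono fun y => lintegral_maxFun_sq_le (hH.comp measurable_prodMk_left)

/-- Averages over dyadic rectangles are bounded by the iterated maximal function. -/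
lemma average_le_maxFun {H : ℝ × ℝ → ℝ≥0∞} (hH : Measurable H) (R : DyadicRectangle)
    {x : ℝ × ℝ} (hx : x ∈ R.toSet) :
    (volume R.toSet)⁻¹ * ∫⁻ z in R.toSet, H z ≤ maxFunSnd (maxFunFst H) x := by
  refine le_trans ?_ (le_maxFun (fun t => maxFunFst H (x.1, t)) hx.2)
  have h1 : ∫⁻ z in R.toSet, H z = ∫⁻ y in R.2.toSet, ∫⁻ t in R.1.toSet, H (t, y) := by
    rw [DyadicRectangle.toSet, Measure.volume_eq_prod, ← Measure.prod_restrict,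
      lintegral_prod_symm' _ hH]
  have h2 : volume R.toSet = volume R.2.toSet * volume R.1.toSet := by
    rw [DyadicRectangle.toSet, Measure.volume_eq_prod, Measure.prod_prod, mul_comm]
  rw [h1, h2, ENNReal.mul_inv (Or.inl R.2.volume_toSet_ne_zero)
    (Or.inl R.2.volume_toSet_ne_top), mul_assoc,
    ← lintegral_const_mul _ hH.lintegral_prod_left']
  gcongr with y
  exact le_maxFun (fun t => H (t, y)) hx.1

end Maximal

/-! ### Sweeps of Carleson families and the upper bound -/

/-- The function `∑ R ∈ s, β R χ_R / |R|` with values in `[0, ∞]`. -/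
noncomputable def sweep (s : Finset DyadicRectangle) (β : DyadicRectangle → ℝ≥0∞)
    (x : ℝ × ℝ) : ℝ≥0∞ :=
  ∑ R ∈ s, β R * (volume R.toSet)⁻¹ * R.toSet.indicator 1 x

lemma measurable_sweep (s : Finset DyadicRectangle) (β : DyadicRectangle → ℝ≥0∞) :
    Measurable (sweep s β) :=
  Finset.measurable_fun_sum _ fun R _ =>
    (measurable_one.indicator R.measurableSet_toSet).const_mul _

/-- With `H` the sweep itself, the squared `L²` norm becomes a Carleson sum of averages. -/
lemma lintegral_sweep_mul (s : Finset DyadicRectangle) (β : DyadicRectangle → ℝ≥0∞)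
    {H : ℝ × ℝ → ℝ≥0∞} (hH : Measurable H) :
    ∫⁻ x, sweep s β x * H x
      = ∑ R ∈ s, β R * ((volume R.toSet)⁻¹ * ∫⁻ x in R.toSet, H x) := by
  simp only [sweep, Finset.sum_mul, mul_assoc]
  have hm : ∀ R : DyadicRectangle, Measurable fun x => R.toSet.indicator 1 x * H x := fun R =>
    (measurable_one.indicator R.measurableSet_toSet).mul hH
  rw [lintegral_finsetSum _ fun R _ => ((hm R).const_mul _).const_mul _]
  refine Finset.sum_congr rfl fun R _ => ?_
  rw [lintegral_const_mul _ ((hm R).const_mul _), lintegral_const_mul _ (hm R),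
    ← lintegral_indicator R.measurableSet_toSet]
  congr 3
  funext x
  by_cases hx : x ∈ R.toSet <;> simp [hx]

lemma two_mul_le_sq_add_sq (a b : ℝ≥0∞) : 2 * a * b ≤ a ^ 2 + b ^ 2 := by
  wlog h : a ≤ b generalizing a b
  · have := this b a (le_of_not_ge h)
    rwa [mul_right_comm, add_comm] at this
  obtain ⟨d, rfl⟩ := exists_add_of_le h
  calc 2 * a * (a + d) ≤ 2 * a * (a + d) + d ^ 2 := le_self_add
    _ = _ := by ring

/-- The averaged sum of a Carleson family is square integrable with the expected bound. -/
lemma lintegral_sweep_sq_le {s : Finset DyadicRectangle} {β : DyadicRectangle → ℝ≥0∞} {A : ℝ≥0∞}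
    (hβ : ∀ R ∈ s, β R ≠ ∞)
    (hA : ∀ t ⊆ s, ∑ R ∈ t, β R ≤ A * volume (⋃ R ∈ t, R.toSet)) :
    ∫⁻ x, sweep s β x ^ 2 ≤ (64 * A ^ 2) * volume (⋃ R ∈ s, R.toSet) := by
  have hH := measurable_sweep s β
  set U := ⋃ R ∈ s, R.toSet with hU
  set W := maxFunSnd (maxFunFst (sweep s β)) with hW
  have hWm : Measurable W := measurable_maxFunSnd (measurable_maxFunFst hH)
  set X := ∫⁻ x, sweep s β x ^ 2 with hX
  have hXeq : X = ∑ R ∈ s, β R * ((volume R.toSet)⁻¹ * ∫⁻ x in R.toSet, sweep s β x) := by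
    rw [← lintegral_sweep_mul s β hH, hX]
    simp only [pow_two]
  have hsweep : ∀ x, sweep s β x ≤ ∑ R ∈ s, β R * (volume R.toSet)⁻¹ := fun x => by
    refine Finset.sum_le_sum fun R _ => mul_le_of_le_one_right' ?_
    exact Set.indicator_le_self' (fun _ _ => zero_le) x
  have hsumfin : ∑ R ∈ s, β R * (volume R.toSet)⁻¹ ≠ ∞ := by
    refine (ENNReal.sum_lt_top.mpr fun R hR => ?_).ne
    refine ENNReal.mul_lt_top (hβ R hR).lt_top (ENNReal.inv_lt_top.mpr ?_)
    rw [DyadicRectangle.volume_toSet]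
    exact ENNReal.ofReal_pos.mpr R.area_pos
  -- Finiteness is what permits `64 * X` to be cancelled at the end.
  have hXfin : X ≠ ∞ := by
    rw [hXeq]
    refine (ENNReal.sum_lt_top.mpr fun R hR => ?_).ne
    refine ENNReal.mul_lt_top (hβ R hR).lt_top (ENNReal.mul_lt_top (ENNReal.inv_lt_top.mpr ?_) ?_)
    · rw [DyadicRectangle.volume_toSet]
      exact ENNReal.ofReal_pos.mpr R.area_pos
    · refine (setLIntegral_mono measurable_const fun x _ => hsweep x).trans_lt ?_
      rw [setLIntegral_const]
      exact ENNReal.mul_lt_top hsumfin.lt_top R.volume_toSet_ne_top.lt_top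
  have hWX : ∫⁻ x, W x ^ 2 ≤ 64 * X := by
    calc ∫⁻ x, W x ^ 2 ≤ 8 * ∫⁻ x, maxFunFst (sweep s β) x ^ 2 :=
          lintegral_maxFunSnd_sq_le (measurable_maxFunFst hH)
      _ ≤ 8 * (8 * X) := by
          gcongr
          exact lintegral_maxFunFst_sq_le hH
      _ = 64 * X := by rw [← mul_assoc]; norm_num
  have h1 : X ≤ A * ∫⁻ x in U, W x := by
    rw [hXeq]
    exact carleson_embedding hA hWm fun R _ x hx => average_le_maxFun hH R hx
  -- The factor `64 = 8 · 8` is the `L²` constant of the iterated maximal function; doubling `64 *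
  -- X` leaves one copy after absorbing `∫ W²`.
  have h2 : 64 * X + 64 * X ≤ 64 * (64 * A ^ 2 * volume U) + 64 * X := by
    calc 64 * X + 64 * X = 128 * X := by ring
      _ ≤ 128 * (A * ∫⁻ x in U, W x) := by gcongr
      _ = ∫⁻ x in U, 2 * (64 * A) * W x := by
          rw [lintegral_const_mul _ hWm]
          ring
      _ ≤ ∫⁻ x in U, ((64 * A) ^ 2 + W x ^ 2) :=
          lintegral_mono fun x => two_mul_le_sq_add_sq _ _
      _ = (64 * A) ^ 2 * volume U + ∫⁻ x in U, W x ^ 2 := by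
          rw [lintegral_add_left measurable_const, setLIntegral_const]
      _ ≤ (64 * A) ^ 2 * volume U + 64 * X := by
          gcongr
          exact (setLIntegral_le_lintegral _ _).trans hWX
      _ = _ := by ring
  have h3 := (ENNReal.add_le_add_iff_right (ENNReal.mul_ne_top (by simp) hXfin)).mp h2
  exact (ENNReal.mul_le_mul_iff_right (by simp) (by simp)).mp h3

/-- The Haar coefficient of `χ_R` at `Q` vanishes unless `R ⊆ Q`. -/
lemma haarCoeff_ind_eq_zero {R Q : DyadicRectangle} (h : ¬ R.toSet ⊆ Q.toSet) :
    haarCoeff R.ind Q = 0 := by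
  have key : ∀ I J : DyadicInterval, ¬ I.toSet ⊆ J.toSet → ∫ x, I.ind x * J.haar x = 0 := by
    intro I J hIJ
    refine integral_mul_haar_eq_zero fun x hx y hy => ?_
    -- If `J` is no longer than `I`, then `χ_I` is constant on `J`; otherwise `I` is shorter but not
    -- inside `J`, hence disjoint from it.
    rcases le_or_gt J.scale I.scale with hs | hs
    · exact ind_eq_of_mem hs hx hy
    · have hz : ∀ z ∈ J.toSet, I.ind z = 0 := fun z hz =>
        ind_of_notMem fun hI => hIJ (toSet_subset_of_mem hs.le hI hz)
      rw [hz x hx, hz y hy]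
  simp only [haarCoeff, DyadicRectangle.ind, DyadicRectangle.haar]
  rw [integral_tensor_mul_tensor]
  by_cases h1 : R.1.toSet ⊆ Q.1.toSet
  · have h2 : ¬ R.2.toSet ⊆ Q.2.toSet := fun h2 => h (Set.prod_mono h1 h2)
    rw [key _ _ h2, mul_zero]
  · rw [key _ _ h1, zero_mul]

lemma haarCoeff_sum_ind (s : Finset DyadicRectangle) (a : DyadicRectangle → ℝ)
    (Q : DyadicRectangle) :
    haarCoeff (fun x => ∑ R ∈ s, a R * R.ind x) Q = ∑ R ∈ s, a R * haarCoeff R.ind Q := by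
  simp only [haarCoeff, Finset.sum_mul, mul_assoc]
  rw [integral_finsetSum _ fun R _ => (R.memLp_ind.integrable_mul Q.memLp_haar).const_mul _]
  simp only [integral_const_mul]

lemma piStarFun_eq {f g : DyadicDistribution} {s : Finset DyadicRectangle}
    (hs : ∀ R, f R * g R ≠ 0 → R ∈ s) :
    piStarFun g f = fun x => ∑ R ∈ s, (f R * g R / R.area) * R.ind x := by
  funext x
  rw [piStarFun, finsum_eq_sum_of_support_subset (s := s)]
  · refine Finset.sum_congr rfl fun R _ => ?_
    rw [R.ind_eq]
    ring
  · intro R hR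
    exact hs R (left_ne_zero_of_mul hR)

/-- Bessel's inequality, after dominating the function pointwise by the sweep of the Carleson family
`|f R * g R|`. -/
lemma sum_haarCoeff_sweep_le {s t : Finset DyadicRectangle} {f g : DyadicDistribution}
    (hf : bmoNorm f ≠ ∞) (hg : bmoNorm g ≠ ∞) :
    ∑ Q ∈ t, ENNReal.ofReal
        (haarCoeff (fun x => ∑ R ∈ s, (f R * g R / R.area) * R.ind x) Q ^ 2)
      ≤ (8 * (bmoNorm f * bmoNorm g)) ^ 2 * volume (⋃ R ∈ s, R.toSet) := by
  set F : ℝ × ℝ → ℝ := fun x => ∑ R ∈ s, (f R * g R / R.area) * R.ind x with hF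
  have hFm : MemLp F 2 volume := memLp_finsetSum _ fun S _ => S.memLp_ind.const_mul _
  have hpt : ∀ x, ENNReal.ofReal (F x ^ 2)
      ≤ sweep s (fun R => ENNReal.ofReal |f R * g R|) x ^ 2 := by
    intro x
    rw [← sq_abs, ENNReal.ofReal_pow (abs_nonneg _)]
    gcongr
    calc ENNReal.ofReal |F x|
        ≤ ENNReal.ofReal (∑ R ∈ s, |f R * g R| * (R.area⁻¹ * R.ind x)) := by
          refine ENNReal.ofReal_le_ofReal ((Finset.abs_sum_le_sum_abs _ _).trans_eq ?_)
          refine Finset.sum_congr rfl fun R _ => ?_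
          have h0 : 0 ≤ R.ind x := by
            rw [R.ind_eq]
            exact Set.indicator_nonneg (fun _ _ => zero_le_one) _
          rw [abs_mul, abs_div, abs_of_pos R.area_pos, abs_of_nonneg h0]
          ring
      _ = sweep s (fun R => ENNReal.ofReal |f R * g R|) x := by
          rw [ENNReal.ofReal_sum_of_nonneg, sweep]
          · refine Finset.sum_congr rfl fun R _ => ?_
            rw [ENNReal.ofReal_mul (abs_nonneg _), ENNReal.ofReal_mul (inv_pos.mpr R.area_pos).le,
              ENNReal.ofReal_inv_of_pos R.area_pos, R.volume_toSet, mul_assoc, R.ind_eq]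
            by_cases hx : x ∈ R.toSet <;> simp [hx]
          · intro R _
            have h0 : 0 ≤ R.ind x := by
              rw [R.ind_eq]
              exact Set.indicator_nonneg (fun _ _ => zero_le_one) _
            have := R.area_pos
            positivity
  calc ∑ Q ∈ t, ENNReal.ofReal (haarCoeff F Q ^ 2)
      = ENNReal.ofReal (∑ Q ∈ t, haarCoeff F Q ^ 2) :=
        (ENNReal.ofReal_sum_of_nonneg fun _ _ => sq_nonneg _).symm
    _ ≤ ENNReal.ofReal (∫ x, F x ^ 2) := ENNReal.ofReal_le_ofReal (sum_haarCoeff_sq_le hFm t)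
    _ = ∫⁻ x, ENNReal.ofReal (F x ^ 2) :=
        ofReal_integral_eq_lintegral_ofReal hFm.integrable_sq
          (Filter.Eventually.of_forall fun _ => sq_nonneg _)
    _ ≤ ∫⁻ x, sweep s (fun R => ENNReal.ofReal |f R * g R|) x ^ 2 := lintegral_mono hpt
    _ ≤ 64 * (bmoNorm f * bmoNorm g) ^ 2 * volume (⋃ R ∈ s, R.toSet) :=
        lintegral_sweep_sq_le (fun _ _ => ENNReal.ofReal_ne_top)
          fun r _ => sum_abs_mul_le hf hg r
    _ = _ := by
        rw [mul_pow 8]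
        norm_num

/-- The upper bound for the operator `π_g^*`. -/
lemma bmoNorm_piStar_le {f g : DyadicDistribution} (hfin : {R | g R ≠ 0}.Finite)
    (hf : bmoNorm f ≠ ∞) (hg : bmoNorm g ≠ ∞) :
    bmoNorm (piStar g f) ≤ 8 * (bmoNorm f * bmoNorm g) := by
  classical
  refine bmoNorm_le fun Ω _ _ _ t ht => ?_
  have hs : ∀ R, f R * g R ≠ 0 → R ∈ hfin.toFinset := fun R hR => by
    simpa using right_ne_zero_of_mul hR
  -- Localization: if `Q ⊆ Ω`, a rectangle contributing to the coefficient at `Q` lies in `Q`, hence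
  -- in `Ω`.
  set s := hfin.toFinset.filter fun R => R.toSet ⊆ Ω with hsdef
  have hcoeff : ∀ Q ∈ t, piStar g f Q
      = haarCoeff (fun x => ∑ R ∈ s, (f R * g R / R.area) * R.ind x) Q := by
    intro Q hQ
    rw [piStar, piStarFun_eq hs, haarCoeff_sum_ind, haarCoeff_sum_ind]
    refine (Finset.sum_subset (Finset.filter_subset _ _) fun R hR hR' => ?_).symm
    rw [haarCoeff_ind_eq_zero, mul_zero]
    intro hRQ
    exact hR' (Finset.mem_filter.mpr ⟨hR, hRQ.trans (ht Q hQ)⟩)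
  rw [Finset.sum_congr rfl fun Q hQ => by rw [hcoeff Q hQ]]
  refine (sum_haarCoeff_sweep_le hf hg).trans ?_
  gcongr
  exact Set.iUnion₂_subset fun R hR => (Finset.mem_filter.mp hR).2

/-! ### Haar sums with little mass on a given set -/

/-- A function that is constant on the maximal intervals of density exceeding `ε` in `E` has
little mass on `E`. -/
lemma setLIntegral_le_of_eq_on_maximals {E : Set ℝ} (hfin : volume E ≠ ∞)
    (hdy : ∀ y ∈ E, ∃ J : DyadicInterval, y ∈ J.toSet ∧ J.toSet ⊆ E) {ε : ℝ≥0∞} (h0 : ε ≠ 0)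
    (h1 : ε < 1) {φ : ℝ → ℝ≥0∞}
    (hφ : ∀ K ∈ dense (volume.restrict E) ε, ∀ x ∈ K.toSet, ∀ y ∈ K.toSet, φ x = φ y) :
    ∫⁻ x in E, φ x ≤ 2 * ε * ∫⁻ x, φ x := by
  set S := dense (volume.restrict E) ε with hS
  obtain ⟨N, hN⟩ := exists_scale_le_of_mem_dense (ν := volume.restrict E) (by simpa using hfin) h0
  -- Every point of `E` lies in a dyadic interval inside `E`, which has density `1 > ε`.
  have hcover : E ⊆ ⋃ K ∈ maximals S, K.toSet := by
    rw [← biUnion_maximals hN]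
    intro y hy
    obtain ⟨J, hyJ, hJE⟩ := hdy y hy
    refine Set.mem_biUnion (x := J) ?_ hyJ
    change ε * volume J.toSet < _
    rw [Measure.restrict_apply J.measurableSet_toSet, Set.inter_eq_left.mpr hJE]
    calc ε * volume J.toSet < 1 * volume J.toSet :=
          ENNReal.mul_lt_mul_left J.volume_toSet_ne_zero J.volume_toSet_ne_top h1
      _ = _ := one_mul _
  -- As `φ` is constant on `K`, the share of its mass on `E` is the density of `E` in `K`, at most
  -- `2ε` by maximality.
  have hK : ∀ K ∈ maximals S, ∫⁻ x in K.toSet, φ x ∂(volume.restrict E)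
      ≤ 2 * ε * ∫⁻ x in K.toSet, φ x := by
    intro K hK
    obtain ⟨z, hz⟩ := K.toSet_nonempty
    have hc : ∀ ν : Measure ℝ, ∫⁻ x in K.toSet, φ x ∂ν = φ z * ν K.toSet := fun ν => by
      rw [setLIntegral_congr_fun K.measurableSet_toSet fun x hx => hφ K hK.1 x hx z hz,
        setLIntegral_const]
    rw [hc, hc, mul_left_comm]
    gcongr
    exact measure_le_of_mem_maximals_dense hK
  have hm : ∀ K ∈ maximals S, MeasurableSet K.toSet := fun K _ => K.measurableSet_toSet
  calc ∫⁻ x in E, φ x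
      = ∫⁻ x in ⋃ K ∈ maximals S, K.toSet, φ x ∂(volume.restrict E) := by
        rw [Measure.restrict_restrict
          (MeasurableSet.biUnion (Set.to_countable _) hm), Set.inter_eq_right.mpr hcover]
    _ = ∑' K : maximals S, ∫⁻ x in K.1.toSet, φ x ∂(volume.restrict E) :=
        lintegral_biUnion (Set.to_countable _) hm (pairwiseDisjoint_maximals S) _
    _ ≤ ∑' K : maximals S, 2 * ε * ∫⁻ x in K.1.toSet, φ x :=
        ENNReal.tsum_le_tsum fun K => hK K.1 K.2
    _ = 2 * ε * ∫⁻ x in ⋃ K ∈ maximals S, K.toSet, φ x := by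
        rw [ENNReal.tsum_mul_left,
          lintegral_biUnion (Set.to_countable _) hm (pairwiseDisjoint_maximals S)]
    _ ≤ _ := by
        exact mul_le_mul_right (setLIntegral_le_lintegral _ _) _

lemma lintegral_sum_haar_sq (s : Finset DyadicInterval) (a : DyadicInterval → ℝ) :
    ∫⁻ x, ENNReal.ofReal ((∑ J ∈ s, a J * J.haar x) ^ 2)
      = ∑ J ∈ s, ENNReal.ofReal (a J ^ 2) := by
  have hw : MemLp (fun x => ∑ J ∈ s, a J * J.haar x) 2 volume :=
    memLp_finsetSum _ fun J _ => J.memLp_haar.const_mul _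
  rw [← ofReal_integral_eq_lintegral_ofReal hw.integrable_sq
    (Filter.Eventually.of_forall fun _ => sq_nonneg _),
    integral_sum_sq (fun J => memLp_haar J) (fun J => J.integral_haar_mul_self)
      (fun I J h => integral_haar_mul_haar h),
    ENNReal.ofReal_sum_of_nonneg fun _ _ => sq_nonneg _]

/-- Finite Haar sums over intervals without dense ancestors have little mass on `E`. -/
lemma setLIntegral_sum_haar_le {E : Set ℝ} (hfin : volume E ≠ ∞)
    (hdy : ∀ y ∈ E, ∃ J : DyadicInterval, y ∈ J.toSet ∧ J.toSet ⊆ E) {ε : ℝ≥0∞} (h0 : ε ≠ 0)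
    (h1 : ε < 1) {s : Finset DyadicInterval} {a : DyadicInterval → ℝ}
    (ha : ∀ J, a J ≠ 0 → ∀ K ∈ dense (volume.restrict E) ε, ¬ J.toSet ⊆ K.toSet) :
    ∫⁻ x in E, ENNReal.ofReal ((∑ J ∈ s, a J * J.haar x) ^ 2)
      ≤ 2 * ε * ∑ J ∈ s, ENNReal.ofReal (a J ^ 2) := by
  rw [← lintegral_sum_haar_sq]
  refine setLIntegral_le_of_eq_on_maximals hfin hdy h0 h1 fun K hK x hx y hy => ?_
  congr 2
  refine Finset.sum_congr rfl fun J _ => ?_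
  rcases eq_or_ne (a J) 0 with h | h
  · rw [h, zero_mul, zero_mul]
  · rw [haar_eq_of_mem (ha J h K hK) hx hy]

/-- The horizontal slice of a planar set at height `y`. -/
def slice (U : Set (ℝ × ℝ)) (y : ℝ) : Set ℝ := (fun x => (x, y)) ⁻¹' U

lemma measurableSet_slice {U : Set (ℝ × ℝ)} (hU : MeasurableSet U) (y : ℝ) :
    MeasurableSet (slice U y) := hU.preimage measurable_prodMk_right

/-- The heights at which `I` has an ancestor of density exceeding `ε` in the slice of `U`. -/
def denseHeights (U : Set (ℝ × ℝ)) (ε : ℝ≥0∞) (I : DyadicInterval) : Set ℝ :=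
  {y | ∃ K ∈ dense (volume.restrict (slice U y)) ε, I.toSet ⊆ K.toSet}

lemma measurableSet_denseHeights {U : Set (ℝ × ℝ)} (hU : MeasurableSet U) (ε : ℝ≥0∞)
    (I : DyadicInterval) : MeasurableSet (denseHeights U ε I) := by
  have : denseHeights U ε I = ⋃ K : DyadicInterval, ⋃ _ : I.toSet ⊆ K.toSet,
      {y | ε * volume K.toSet
        < volume ((fun x => (x, y)) ⁻¹' ((Prod.fst ⁻¹' K.toSet) ∩ U))} := by
    ext y
    simp only [denseHeights, Set.mem_ofPred_eq, Set.mem_iUnion, exists_prop]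
    refine exists_congr fun K => ?_
    rw [and_comm]
    refine and_congr_right fun _ => ?_
    change ε * volume K.toSet < _ ↔ _
    rw [Measure.restrict_apply K.measurableSet_toSet]
    rfl
  rw [this]
  refine MeasurableSet.iUnion fun K => MeasurableSet.iUnion fun _ => ?_
  exact measurableSet_lt measurable_const
    (measurable_measure_prodMk_right ((K.measurableSet_toSet.preimage measurable_fst).inter hU))

/-- The union of a finite family of dyadic rectangles. -/
def rectUnion (s : Finset DyadicRectangle) : Set (ℝ × ℝ) := ⋃ R ∈ s, R.toSet

lemma measurableSet_rectUnion (s : Finset DyadicRectangle) : MeasurableSet (rectUnion s) :=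
  s.measurableSet_biUnion fun R _ => R.measurableSet_toSet

lemma volume_rectUnion_ne_top (s : Finset DyadicRectangle) : volume (rectUnion s) ≠ ∞ :=
  ((measure_biUnion_finset_le _ _).trans_lt
    (ENNReal.sum_lt_top.mpr fun R _ => R.volume_toSet_ne_top.lt_top)).ne

lemma mem_slice_rectUnion {s : Finset DyadicRectangle} {x y : ℝ} :
    x ∈ slice (rectUnion s) y ↔ ∃ R ∈ s, x ∈ R.1.toSet ∧ y ∈ R.2.toSet := by
  simp only [slice, rectUnion, Set.mem_preimage, Set.mem_iUnion, exists_prop]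
  rfl

lemma exists_subset_slice {s : Finset DyadicRectangle} {x y : ℝ}
    (hx : x ∈ slice (rectUnion s) y) :
    ∃ J : DyadicInterval, x ∈ J.toSet ∧ J.toSet ⊆ slice (rectUnion s) y := by
  obtain ⟨R, hR, hxR, hyR⟩ := mem_slice_rectUnion.mp hx
  exact ⟨R.1, hxR, fun z hz => mem_slice_rectUnion.mpr ⟨R, hR, hz, hyR⟩⟩

lemma volume_slice_ne_top (s : Finset DyadicRectangle) (y : ℝ) :
    volume (slice (rectUnion s) y) ≠ ∞ := by
  refine ((measure_mono (t := ⋃ R ∈ s, R.1.toSet) fun x hx => ?_).trans_lt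
    ((measure_biUnion_finset_le _ _).trans_lt
      (ENNReal.sum_lt_top.mpr fun R _ => R.1.volume_toSet_ne_top.lt_top))).ne
  obtain ⟨R, hR, hxR, -⟩ := mem_slice_rectUnion.mp hx
  exact Set.mem_biUnion (s := (s : Set DyadicRectangle)) hR hxR

lemma volume_denseHeights_ne_top (s : Finset DyadicRectangle) (ε : ℝ≥0∞) (I : DyadicInterval) :
    volume (denseHeights (rectUnion s) ε I) ≠ ∞ := by
  refine ((measure_mono (t := ⋃ R ∈ s, R.2.toSet) fun y hy => ?_).trans_lt
    ((measure_biUnion_finset_le _ _).trans_lt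
      (ENNReal.sum_lt_top.mpr fun R _ => R.2.volume_toSet_ne_top.lt_top))).ne
  obtain ⟨K, hK, -⟩ := hy
  have hne : (slice (rectUnion s) y).Nonempty := by
    rw [Set.nonempty_iff_ne_empty]
    intro h
    rw [h, Measure.restrict_empty] at hK
    exact not_lt_zero (show ε * volume K.toSet < 0 from hK)
  obtain ⟨x, hx⟩ := hne
  obtain ⟨R, hR, -, hyR⟩ := mem_slice_rectUnion.mp hx
  exact Set.mem_biUnion (s := (s : Set DyadicRectangle)) hR hyR

lemma exists_subset_denseHeights {s : Finset DyadicRectangle} {ε : ℝ≥0∞} {I : DyadicInterval}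
    {y : ℝ} (hy : y ∈ denseHeights (rectUnion s) ε I) :
    ∃ J : DyadicInterval, y ∈ J.toSet ∧ J.toSet ⊆ denseHeights (rectUnion s) ε I := by
  -- Slices do not change within a dyadic interval of heights no longer than every vertical side.
  obtain ⟨n, hn⟩ : ∃ n : ℤ, ∀ R ∈ s, n ≤ R.2.scale := by
    obtain ⟨n, hn⟩ := (s.image fun R => R.2.scale).bddBelow
    exact ⟨n, fun R hR => hn (Finset.mem_coe.mpr (Finset.mem_image_of_mem _ hR))⟩
  refine ⟨around n y, mem_around n y, fun y' hy' => ?_⟩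
  have : slice (rectUnion s) y' = slice (rectUnion s) y := by
    ext x
    rw [mem_slice_rectUnion, mem_slice_rectUnion]
    refine exists_congr fun R => and_congr_right fun hR => and_congr_right fun _ => ?_
    exact mem_iff_mem (K := around n y) (hn R hR) hy' (mem_around n y)
  change ∃ K ∈ dense (volume.restrict (slice (rectUnion s) y')) ε, I.toSet ⊆ K.toSet
  rw [this]
  exact hy

/-- Finite Haar sums over rectangles that are not captured by the two step enlargement of a union
of rectangles have little mass on that union. -/
lemma setLIntegral_sum_haar_rect_le (s : Finset DyadicRectangle) {ε : ℝ≥0∞} (h0 : ε ≠ 0)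
    (h1 : ε < 1) (T₁ T₂ : Finset DyadicInterval) {a : DyadicRectangle → ℝ}
    (ha : ∀ I J, a (I, J) ≠ 0 →
      ∀ K ∈ dense (volume.restrict (denseHeights (rectUnion s) ε I)) ε, ¬ J.toSet ⊆ K.toSet) :
    ∫⁻ x in rectUnion s,
        ENNReal.ofReal ((∑ I ∈ T₁, ∑ J ∈ T₂, a (I, J) * (I.haar x.1 * J.haar x.2)) ^ 2)
      ≤ 8 * ε * ∑ I ∈ T₁, ∑ J ∈ T₂, ENNReal.ofReal (a (I, J) ^ 2) := by
  classical
  set U := rectUnion s with hU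
  have hUm : MeasurableSet U := measurableSet_rectUnion s
  set w : DyadicInterval → ℝ → ℝ := fun I y => ∑ J ∈ T₂, a (I, J) * J.haar y with hw
  have hwm : ∀ I, Measurable (w I) := fun I =>
    Finset.measurable_fun_sum _ fun J _ => J.measurable_haar.const_mul _
  have hEm : ∀ I, MeasurableSet (denseHeights U ε I) := measurableSet_denseHeights hUm ε
  have hsum : ∀ x : ℝ × ℝ, ∑ I ∈ T₁, ∑ J ∈ T₂, a (I, J) * (I.haar x.1 * J.haar x.2)
      = ∑ I ∈ T₁, w I x.2 * I.haar x.1 := fun x => by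
    refine Finset.sum_congr rfl fun I _ => ?_
    rw [hw, Finset.sum_mul]
    exact Finset.sum_congr rfl fun J _ => by ring
  simp only [hsum]
  have hslice : ∀ y, ∫⁻ x in slice U y, ENNReal.ofReal ((∑ I ∈ T₁, w I y * I.haar x) ^ 2)
      ≤ ∑ I ∈ T₁, (2 * (denseHeights U ε I).indicator (fun y => ENNReal.ofReal (w I y ^ 2)) y
        + 4 * ε * ENNReal.ofReal (w I y ^ 2)) := by
    intro y
    -- Split the intervals `I` by whether they have a dense ancestor at height `y`. Those in `c`
    -- have none, so the one-variable estimate gains `2ε`. Those in `b` get only orthogonality here;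
    -- their gain comes from integrating `w I` over its dense heights.
    set b : DyadicInterval → ℝ := fun I => if y ∈ denseHeights U ε I then w I y else 0 with hb
    set c : DyadicInterval → ℝ := fun I => if y ∈ denseHeights U ε I then 0 else w I y with hc
    have hbc : ∀ I, w I y = b I + c I := fun I => by
      simp only [hb, hc]
      split_ifs <;> simp
    have hm : ∀ b : DyadicInterval → ℝ,
        Measurable fun x => ENNReal.ofReal ((∑ I ∈ T₁, b I * I.haar x) ^ 2) := fun b =>
      ((Finset.measurable_fun_sum _ fun J _ =>
        J.measurable_haar.const_mul _).pow_const 2).ennreal_ofReal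
    calc ∫⁻ x in slice U y, ENNReal.ofReal ((∑ I ∈ T₁, w I y * I.haar x) ^ 2)
        ≤ ∫⁻ x in slice U y, (2 * ENNReal.ofReal ((∑ I ∈ T₁, b I * I.haar x) ^ 2)
          + 2 * ENNReal.ofReal ((∑ I ∈ T₁, c I * I.haar x) ^ 2)) := by
          refine lintegral_mono fun x => ?_
          have h2 : (2 : ℝ≥0∞) = ENNReal.ofReal 2 := by simp
          simp only
          rw [h2, ← ENNReal.ofReal_mul zero_le_two, ← ENNReal.ofReal_mul zero_le_two,
            ← ENNReal.ofReal_add (by positivity) (by positivity)]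
          refine ENNReal.ofReal_le_ofReal ?_
          simp only [hbc, add_mul, Finset.sum_add_distrib]
          nlinarith [sq_nonneg (∑ I ∈ T₁, b I * I.haar x - ∑ I ∈ T₁, c I * I.haar x)]
      _ = 2 * (∫⁻ x in slice U y, ENNReal.ofReal ((∑ I ∈ T₁, b I * I.haar x) ^ 2))
          + 2 * ∫⁻ x in slice U y, ENNReal.ofReal ((∑ I ∈ T₁, c I * I.haar x) ^ 2) := by
          rw [lintegral_add_left ((hm b).const_mul 2), lintegral_const_mul _ (hm b),
            lintegral_const_mul _ (hm c)]
      _ ≤ 2 * ∑ I ∈ T₁, ENNReal.ofReal (b I ^ 2)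
          + 2 * (2 * ε * ∑ I ∈ T₁, ENNReal.ofReal (c I ^ 2)) := by
          gcongr
          · rw [← lintegral_sum_haar_sq]
            exact setLIntegral_le_lintegral _ _
          · refine setLIntegral_sum_haar_le (volume_slice_ne_top s y)
              (fun x hx => exists_subset_slice hx) h0 h1 fun I hI K hK hIK => hI ?_
            exact if_pos ⟨K, hK, hIK⟩
      _ ≤ _ := by
          rw [Finset.mul_sum, Finset.mul_sum, Finset.mul_sum, ← Finset.sum_add_distrib]
          refine Finset.sum_le_sum fun I _ => ?_
          refine add_le_add ?_ ?_
          · by_cases hy : y ∈ denseHeights U ε I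
            · simp [hb, hy]
            · simp [hb, hy]
          · calc 2 * (2 * ε * ENNReal.ofReal (c I ^ 2)) = 4 * ε * ENNReal.ofReal (c I ^ 2) := by
                  ring
              _ ≤ _ := by
                  gcongr 4 * ε * ENNReal.ofReal ?_
                  simp only [hc]
                  split_ifs
                  · simpa using sq_nonneg (w I y)
                  · exact le_rfl
  have hFm : Measurable fun x : ℝ × ℝ =>
      ENNReal.ofReal ((∑ I ∈ T₁, w I x.2 * I.haar x.1) ^ 2) :=
    ((Finset.measurable_fun_sum _ fun I _ => ((hwm I).comp measurable_snd).mul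
      (I.measurable_haar.comp measurable_fst)).pow_const 2).ennreal_ofReal
  have hwm2 : ∀ I, Measurable fun y => ENNReal.ofReal (w I y ^ 2) := fun I =>
    ((hwm I).pow_const 2).ennreal_ofReal
  have hterm : ∀ I, Measurable fun y =>
      2 * (denseHeights U ε I).indicator (fun y => ENNReal.ofReal (w I y ^ 2)) y
        + 4 * ε * ENNReal.ofReal (w I y ^ 2) := fun I =>
    (((hwm2 I).indicator (hEm I)).const_mul 2).add ((hwm2 I).const_mul _)
  calc ∫⁻ x in U, ENNReal.ofReal ((∑ I ∈ T₁, w I x.2 * I.haar x.1) ^ 2)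
      = ∫⁻ y, ∫⁻ x in slice U y, ENNReal.ofReal ((∑ I ∈ T₁, w I y * I.haar x) ^ 2) := by
        rw [← lintegral_indicator hUm, Measure.volume_eq_prod,
          lintegral_prod_symm' _ (hFm.indicator hUm)]
        refine lintegral_congr fun y => ?_
        rw [← lintegral_indicator (measurableSet_slice hUm y)]
        rfl
    _ ≤ ∫⁻ y, ∑ I ∈ T₁, (2 * (denseHeights U ε I).indicator
          (fun y => ENNReal.ofReal (w I y ^ 2)) y + 4 * ε * ENNReal.ofReal (w I y ^ 2)) :=
        lintegral_mono hslice
    _ = ∑ I ∈ T₁, (2 * (∫⁻ y in denseHeights U ε I, ENNReal.ofReal (w I y ^ 2))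
          + 4 * ε * ∫⁻ y, ENNReal.ofReal (w I y ^ 2)) := by
        rw [lintegral_finsetSum _ fun I _ => hterm I]
        refine Finset.sum_congr rfl fun I _ => ?_
        rw [lintegral_add_left (((hwm2 I).indicator (hEm I)).const_mul 2),
          lintegral_const_mul _ ((hwm2 I).indicator (hEm I)), lintegral_const_mul _ (hwm2 I),
          lintegral_indicator (hEm I)]
    -- The one-variable estimate is used again, now in `y` on the dense heights of `I`; the total is
    -- `2 · 2ε + 4ε = 8ε`.
    _ ≤ ∑ I ∈ T₁, (2 * (2 * ε * ∑ J ∈ T₂, ENNReal.ofReal (a (I, J) ^ 2))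
          + 4 * ε * ∑ J ∈ T₂, ENNReal.ofReal (a (I, J) ^ 2)) := by
        refine Finset.sum_le_sum fun I _ => ?_
        gcongr
        · exact setLIntegral_sum_haar_le (volume_denseHeights_ne_top s ε I)
            (fun y hy => exists_subset_denseHeights hy) h0 h1 fun J hJ => ha I J hJ
        · exact (lintegral_sum_haar_sq T₂ fun J => a (I, J)).le
    _ = _ := by
        rw [Finset.mul_sum]
        exact Finset.sum_congr rfl fun I _ => by ring

/-! ### The enlargement and the energy outside it -/

/-- The two step enlargement of a planar set. -/
def enlargement (U : Set (ℝ × ℝ)) (ε : ℝ≥0∞) : Set (ℝ × ℝ) :=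
  ⋃ I : DyadicInterval, ⋃ K ∈ dense (volume.restrict (denseHeights U ε I)) ε,
    I.toSet ×ˢ K.toSet

/-- The weak type inequality is used once per variable, with the intermediate set `V` of points `(x,
y)` such that some `I ∋ x` has a dense ancestor at height `y`. Each horizontal section of `V` is
covered by dense intervals of the slice of `U`. For `x ∈ I` the vertical section of `V` contains the
dense heights of `I`, so an interval dense for the latter is dense for the section. -/
lemma volume_enlargement_le {U : Set (ℝ × ℝ)} (hU : MeasurableSet U) (ε : ℝ≥0∞) :
    ε * (ε * volume (enlargement U ε)) ≤ volume U := by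
  set V : Set (ℝ × ℝ) := ⋃ I : DyadicInterval, I.toSet ×ˢ denseHeights U ε I with hV
  have hVm : MeasurableSet V := MeasurableSet.iUnion fun I =>
    I.measurableSet_toSet.prod (measurableSet_denseHeights hU ε I)
  have hEm : MeasurableSet (enlargement U ε) := MeasurableSet.iUnion fun I =>
    MeasurableSet.biUnion (Set.to_countable _) fun K _ =>
      I.measurableSet_toSet.prod K.measurableSet_toSet
  have h1 : ε * volume V ≤ volume U := by
    rw [Measure.volume_eq_prod, Measure.prod_apply_symm hVm, Measure.prod_apply_symm hU,
      ← lintegral_const_mul _ (measurable_measure_prodMk_right hVm)]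
    refine lintegral_mono fun y => ?_
    have h2 := volume_biUnion_dense_le (volume.restrict (slice U y)) ε
    rw [Measure.restrict_apply_univ] at h2
    refine le_trans ?_ h2
    gcongr
    intro x hx
    obtain ⟨I, hxI, K, hK, hIK⟩ := Set.mem_iUnion.mp (show (x, y) ∈ V from hx)
    exact Set.mem_biUnion (x := K) hK (hIK hxI)
  have h3 : ε * volume (enlargement U ε) ≤ volume V := by
    rw [Measure.volume_eq_prod, Measure.prod_apply hVm, Measure.prod_apply hEm,
      ← lintegral_const_mul _ (measurable_measure_prodMk_left hEm)]
    refine lintegral_mono fun x => ?_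
    have h2 := volume_biUnion_dense_le (volume.restrict (Prod.mk x ⁻¹' V)) ε
    rw [Measure.restrict_apply_univ] at h2
    refine le_trans ?_ h2
    gcongr
    intro y hy
    obtain ⟨I, hI⟩ := Set.mem_iUnion.mp (show (x, y) ∈ enlargement U ε from hy)
    simp only [Set.mem_iUnion, exists_prop] at hI
    obtain ⟨K, hK, hxI, hyK⟩ := hI
    refine Set.mem_biUnion (x := K) ?_ hyK
    refine lt_of_lt_of_le (show ε * volume K.toSet < _ from hK) ?_
    refine Measure.restrict_mono (fun z hz => ?_) le_rfl _
    exact Set.mem_iUnion.mpr ⟨I, hxI, hz⟩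
  calc ε * (ε * volume (enlargement U ε)) ≤ ε * volume V := by gcongr
    _ ≤ _ := h1

/-- The Haar coefficients of a function supported in a union of rectangles, over rectangles that
are not captured by its enlargement, carry at most half of the energy. -/
lemma two_mul_sum_haarCoeff_sq_le {s t : Finset DyadicRectangle} {F : ℝ × ℝ → ℝ}
    (hF : MemLp F 2 volume) (hsupp : ∀ x ∉ rectUnion s, F x = 0)
    (ht : ∀ Q ∈ t, ∀ K ∈ dense (volume.restrict (denseHeights (rectUnion s) 16⁻¹ Q.1)) 16⁻¹,
      ¬ Q.2.toSet ⊆ K.toSet) :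
    2 * ∑ Q ∈ t, haarCoeff F Q ^ 2 ≤ ∫ x, F x ^ 2 := by
  classical
  set U := rectUnion s with hU
  set D := ∑ Q ∈ t, haarCoeff F Q ^ 2 with hD
  set w : ℝ × ℝ → ℝ := fun x => ∑ Q ∈ t, haarCoeff F Q * Q.haar x with hw
  have hwm : MemLp w 2 volume := memLp_finsetSum _ fun Q _ => Q.memLp_haar.const_mul _
  have hFw : ∫ x, F x * w x = D := by
    simp only [hw, Finset.mul_sum, mul_left_comm (F _)]
    have hint : ∀ Q : DyadicRectangle, Integrable fun x => haarCoeff F Q * (F x * Q.haar x) :=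
      fun Q => (hF.integrable_mul Q.memLp_haar).const_mul _
    rw [integral_finsetSum _ fun Q _ => hint Q]
    refine Finset.sum_congr rfl fun Q _ => ?_
    rw [integral_const_mul, pow_two]
    rfl
  -- The choice `ε = 1/16` turns the constant `8ε` into `1/2`.
  have hwU : ∫ x in U, w x ^ 2 ≤ D / 2 := by
    set a : DyadicRectangle → ℝ := fun Q => if Q ∈ t then haarCoeff F Q else 0 with ha
    -- The family `t` is padded by zero coefficients to a product of two families of intervals.
    have hprod : ∀ {M : Type} [AddCommMonoid M] (b : DyadicRectangle → M), (∀ Q, a Q = 0 → b Q = 0) →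
        ∑ I ∈ t.image Prod.fst, ∑ J ∈ t.image Prod.snd, b (I, J) = ∑ Q ∈ t, b Q := by
      intro M _ b hb
      rw [← Finset.sum_product']
      refine (Finset.sum_subset (fun Q hQ => ?_) fun Q _ hQ => hb Q (if_neg hQ)).symm
      exact Finset.mem_product.mpr
        ⟨Finset.mem_image_of_mem _ hQ, Finset.mem_image_of_mem _ hQ⟩
    have h := setLIntegral_sum_haar_rect_le s (ε := 16⁻¹) (by simp) (by simp)
      (t.image Prod.fst) (t.image Prod.snd) (a := a) fun I J hIJ K hK => by
        have hQ : (I, J) ∈ t := by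
          by_contra hQ
          exact hIJ (if_neg hQ)
        exact ht (I, J) hQ K hK
    have h1 : ∀ x : ℝ × ℝ, ∑ I ∈ t.image Prod.fst, ∑ J ∈ t.image Prod.snd,
        a (I, J) * (I.haar x.1 * J.haar x.2) = w x := fun x => by
      refine (hprod (fun Q => a Q * Q.haar x) fun Q hQ => by rw [hQ, zero_mul]).trans ?_
      exact Finset.sum_congr rfl fun Q hQ => by rw [ha]; simp only [if_pos hQ]
    have h2 : ∑ I ∈ t.image Prod.fst, ∑ J ∈ t.image Prod.snd, ENNReal.ofReal (a (I, J) ^ 2)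
        = ENNReal.ofReal D := by
      rw [hprod (fun Q => ENNReal.ofReal (a Q ^ 2)) fun Q hQ => by simp [hQ],
        hD, ENNReal.ofReal_sum_of_nonneg fun _ _ => sq_nonneg _]
      exact Finset.sum_congr rfl fun Q hQ => by rw [ha]; simp only [if_pos hQ]
    simp only [h1] at h
    rw [h2, ← ofReal_integral_eq_lintegral_ofReal hwm.integrable_sq.integrableOn
      (Filter.Eventually.of_forall fun _ => sq_nonneg _)] at h
    have h3 : (8 : ℝ≥0∞) * 16⁻¹ * ENNReal.ofReal D = ENNReal.ofReal (D / 2) := by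
      have h4 : (8 : ℝ≥0∞) * 16⁻¹ = ENNReal.ofReal 2⁻¹ := by
        rw [show (8 : ℝ≥0∞) = ENNReal.ofReal 8 by simp, show (16 : ℝ≥0∞) = ENNReal.ofReal 16 by simp,
          ← ENNReal.ofReal_inv_of_pos (by norm_num), ← ENNReal.ofReal_mul (by norm_num)]
        norm_num
      rw [h4, ← ENNReal.ofReal_mul (by norm_num)]
      congr 1
      ring
    rw [h3] at h
    exact (ENNReal.ofReal_le_ofReal_iff
      (div_nonneg (Finset.sum_nonneg fun _ _ => sq_nonneg _) zero_le_two)).mp h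
  have hFU : ∫ x in U, F x * w x = D := by
    rw [← hFw, setIntegral_eq_integral_of_forall_compl_eq_zero]
    intro x hx
    rw [hsupp x hx, zero_mul]
  have hF2 : ∫ x in U, F x ^ 2 = ∫ x, F x ^ 2 := by
    rw [setIntegral_eq_integral_of_forall_compl_eq_zero]
    intro x hx
    rw [hsupp x hx]
    simp
  -- Both sides live on `U`, where `w` is small: this reads `4D ≤ ∫ F² + 4 · D/2`, that is `2D ≤ ∫
  -- F²`.
  have hineq : ∫ x in U, 4 * (F x * w x) ≤ ∫ x in U, (F x ^ 2 + 4 * w x ^ 2) := by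
    refine integral_mono ((hF.integrable_mul hwm).const_mul 4).integrableOn
      (hF.integrable_sq.add (hwm.integrable_sq.const_mul 4)).integrableOn fun x => ?_
    simp only
    nlinarith [sq_nonneg (F x - 2 * w x)]
  rw [integral_const_mul, hFU, integral_add hF.integrable_sq.integrableOn
    (hwm.integrable_sq.const_mul 4).integrableOn, integral_const_mul, hF2] at hineq
  linarith

/-- The `L²` norm of a combination of indicators of rectangles is controlled by its `BMO` norm and
the area of the union of these rectangles. -/
lemma ofReal_integral_sq_le (s : Finset DyadicRectangle) (a : DyadicRectangle → ℝ)
    (hN : bmoNorm (haarCoeff fun x => ∑ R ∈ s, a R * R.ind x) ≠ ∞) :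
    ENNReal.ofReal (∫ x, (∑ R ∈ s, a R * R.ind x) ^ 2)
      ≤ 512 * (bmoNorm (haarCoeff fun x => ∑ R ∈ s, a R * R.ind x) ^ 2
        * volume (rectUnion s)) := by
  classical
  set F : ℝ × ℝ → ℝ := fun x => ∑ R ∈ s, a R * R.ind x with hFdef
  have hF : MemLp F 2 volume := memLp_finsetSum _ fun S _ => S.memLp_ind.const_mul _
  set N := bmoNorm (haarCoeff F) with hNdef
  set U := rectUnion s with hU
  have hsupp : ∀ x ∉ U, F x = 0 := fun x hx => by
    refine Finset.sum_eq_zero fun R hR => ?_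
    rw [R.ind_eq, Set.indicator_of_notMem, mul_zero]
    exact fun h => hx (Set.mem_biUnion (s := (s : Set DyadicRectangle)) hR h)
  have hfin : N ^ 2 * volume U ≠ ∞ :=
    ENNReal.mul_ne_top (ENNReal.pow_ne_top hN) (volume_rectUnion_ne_top s)
  have h16 : (16 : ℝ≥0∞) * 16⁻¹ = 1 := ENNReal.mul_inv_cancel (by simp) (by simp)
  -- Each of the two weak type steps costs a factor 16.
  have hvol : volume (enlargement U 16⁻¹) ≤ 256 * volume U := by
    calc volume (enlargement U 16⁻¹)
        = (16 * 16⁻¹) * ((16 * 16⁻¹) * volume (enlargement U 16⁻¹)) := by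
          rw [h16, one_mul, one_mul]
      _ = 256 * (16⁻¹ * (16⁻¹ * volume (enlargement U 16⁻¹))) := by ring
      _ ≤ 256 * volume U := by
          gcongr
          exact volume_enlargement_le (measurableSet_rectUnion s) _
  have hgood : ∀ t : Finset DyadicRectangle, (∀ Q ∈ t, Q.toSet ⊆ enlargement U 16⁻¹) →
      ∑ Q ∈ t, haarCoeff F Q ^ 2 ≤ 256 * (N ^ 2 * volume U).toReal := by
    intro t ht
    have hV : volume (enlargement U 16⁻¹) ≠ ∞ :=
      (hvol.trans_lt (ENNReal.mul_lt_top (by simp) (volume_rectUnion_ne_top s).lt_top)).ne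
    have h1 := sum_sq_le hN hV ht
    rw [← ENNReal.ofReal_sum_of_nonneg fun _ _ => sq_nonneg _] at h1
    have h2 : ENNReal.ofReal (∑ Q ∈ t, haarCoeff F Q ^ 2) ≤ 256 * (N ^ 2 * volume U) := by
      calc _ ≤ N ^ 2 * volume (enlargement U 16⁻¹) := h1
        _ ≤ N ^ 2 * (256 * volume U) := by gcongr
        _ = _ := by ring
    have h3 := (ENNReal.ofReal_le_iff_le_toReal (ENNReal.mul_ne_top (by simp) hfin)).mp h2
    rwa [ENNReal.toReal_mul, ENNReal.toReal_ofNat] at h3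
  -- Parseval, with coefficients split by whether the enlargement captures `Q`; absorbing the half
  -- of `∫ F²` doubles 256 to 512.
  have hpar : ∫ x, F x ^ 2
      ≤ (∫ x, F x ^ 2) / 2 + 256 * (N ^ 2 * volume U).toReal := by
    refine integral_sq_le_of_sum_haarCoeff_sq_le s a fun t => ?_
    rw [← Finset.sum_filter_add_sum_filter_not t fun Q =>
      ∃ K ∈ dense (volume.restrict (denseHeights U 16⁻¹ Q.1)) 16⁻¹, Q.2.toSet ⊆ K.toSet, add_comm]
    refine add_le_add ?_ ?_
    · have := two_mul_sum_haarCoeff_sq_le hF hsupp (t := t.filter fun Q =>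
        ¬ ∃ K ∈ dense (volume.restrict (denseHeights U 16⁻¹ Q.1)) 16⁻¹, Q.2.toSet ⊆ K.toSet)
        fun Q hQ K hK hQK => (Finset.mem_filter.mp hQ).2 ⟨K, hK, hQK⟩
      linarith
    · refine hgood _ fun Q hQ => ?_
      obtain ⟨K, hK, hQK⟩ := (Finset.mem_filter.mp hQ).2
      exact (Set.prod_mono_right hQK).trans
        ((Set.subset_biUnion_of_mem (u := fun K : DyadicInterval => Q.1.toSet ×ˢ K.toSet) hK).trans
          (Set.subset_iUnion (fun I : DyadicInterval =>
            ⋃ K ∈ dense (volume.restrict (denseHeights U 16⁻¹ I)) 16⁻¹, I.toSet ×ˢ K.toSet) Q.1))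
  rw [ENNReal.ofReal_le_iff_le_toReal (ENNReal.mul_ne_top (by simp) hfin), ENNReal.toReal_mul,
    ENNReal.toReal_ofNat]
  linarith

/-- The Cauchy–Schwarz inequality on a set of finite area. -/
lemma sq_integral_le {F : ℝ × ℝ → ℝ} (hF : MemLp F 2 volume) {U : Set (ℝ × ℝ)}
    (hU : volume U ≠ ∞) (hsupp : ∀ x ∉ U, F x = 0) :
    (∫ x, F x) ^ 2 ≤ (volume U).toReal * ∫ x, F x ^ 2 := by
  have : IsFiniteMeasure (volume.restrict U) := ⟨by simpa using hU.lt_top⟩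
  have h1 : ∫ x in U, F x = ∫ x, F x :=
    setIntegral_eq_integral_of_forall_compl_eq_zero hsupp
  have h2 : ∫ x in U, F x ^ 2 = ∫ x, F x ^ 2 :=
    setIntegral_eq_integral_of_forall_compl_eq_zero fun x hx => by simp [hsupp x hx]
  have hFU : Integrable F (volume.restrict U) :=
    (hF.restrict U).integrable one_le_two
  set B := ∫ x, F x with hB
  set u := (volume U).toReal with hu
  have hu0 : 0 ≤ u := ENNReal.toReal_nonneg
  -- Expanding gives `0 ≤ u (u ∫ F² - B²)`; for `u = 0` the integral `B` vanishes.
  have key : 0 ≤ ∫ x in U, (u * F x - B) ^ 2 := integral_nonneg fun x => sq_nonneg _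
  have hexp : ∀ x, (u * F x - B) ^ 2 = u ^ 2 * F x ^ 2 - 2 * u * B * F x + B ^ 2 := fun x => by
    ring
  have hi1 : Integrable (fun x => u ^ 2 * F x ^ 2) (volume.restrict U) :=
    hF.integrable_sq.integrableOn.const_mul _
  have hi2 : Integrable (fun x => 2 * u * B * F x) (volume.restrict U) := hFU.const_mul _
  have hi3 : Integrable (fun x => u ^ 2 * F x ^ 2 - 2 * u * B * F x) (volume.restrict U) :=
    hi1.sub hi2
  simp only [hexp] at key
  rw [integral_add hi3 (integrable_const _), integral_sub hi1 hi2,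
    integral_const_mul, integral_const_mul,
    h1, h2, integral_const, smul_eq_mul] at key
  have hur : (volume.restrict U).real Set.univ = u := by simp [Measure.real, hu]
  rw [hur] at key
  rcases hu0.eq_or_lt with h0 | h0
  · have hnull : volume U = 0 :=
      ((ENNReal.toReal_eq_zero_iff _).mp h0.symm).resolve_right hU
    have : B = 0 := by rw [← h1, setIntegral_measure_zero _ hnull]
    rw [this, ← h0]
    simp
  · refine le_of_mul_le_mul_left ?_ h0
    linarith

/-! ### The lower bound and the theorem -/

/-- For `R ⊆ Ω` one has `g_R² ≤ (g_R² / |R|) |Ω|`, and only finitely many terms are nonzero. -/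
lemma bmoNorm_ne_top_of_finite {g : DyadicDistribution} (hg : {R | g R ≠ 0}.Finite) :
    bmoNorm g ≠ ∞ := by
  classical
  set X := ∑ R ∈ hg.toFinset, ENNReal.ofReal (g R ^ 2) / volume R.toSet with hX
  have hvol : ∀ R : DyadicRectangle, volume R.toSet ≠ 0 := fun R => by
    rw [R.volume_toSet]
    exact (ENNReal.ofReal_pos.mpr R.area_pos).ne'
  have hXfin : X ≠ ∞ :=
    (ENNReal.sum_lt_top.mpr fun R _ => ENNReal.div_lt_top ENNReal.ofReal_ne_top (hvol R)).ne
  have hle : bmoNorm g ≤ X ^ (1 / 2 : ℝ) := by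
    refine bmoNorm_le fun Ω _ _ _ s hs => ?_
    rw [← ENNReal.rpow_two, ← ENNReal.rpow_mul]
    norm_num
    rw [hX, Finset.sum_mul]
    calc ∑ R ∈ s, ENNReal.ofReal (g R ^ 2)
        ≤ ∑ R ∈ s.filter fun R => g R ≠ 0, ENNReal.ofReal (g R ^ 2) := by
          rw [Finset.sum_filter]
          refine Finset.sum_le_sum fun R _ => ?_
          split_ifs with h
          · exact le_rfl
          · rw [not_not.mp h]
            simp
      _ ≤ ∑ R ∈ s.filter fun R => g R ≠ 0,
            ENNReal.ofReal (g R ^ 2) / volume R.toSet * volume Ω := by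
          refine Finset.sum_le_sum fun R hR => ?_
          calc ENNReal.ofReal (g R ^ 2)
              = ENNReal.ofReal (g R ^ 2) / volume R.toSet * volume R.toSet :=
                (ENNReal.div_mul_cancel (hvol R) R.volume_toSet_ne_top).symm
            _ ≤ _ := by
                gcongr
                exact hs R (Finset.mem_filter.mp hR).1
      _ ≤ _ := by
          refine Finset.sum_le_sum_of_subset fun R hR => ?_
          simpa using (Finset.mem_filter.mp hR).2
  exact (hle.trans_lt (ENNReal.rpow_lt_top_of_nonneg (by norm_num) hXfin)).ne

/-- The lower bound for the operator `π_g^*`. -/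
lemma bmoNorm_le_of_piStar_le {g : DyadicDistribution} (hg : {R | g R ≠ 0}.Finite) {K : ℝ≥0}
    (hK : ∀ f ∈ BMO, bmoNorm (piStar g f) ≤ K * bmoNorm f) : bmoNorm g ≤ 32 * K := by
  classical
  have hG : bmoNorm g ≠ ∞ := bmoNorm_ne_top_of_finite hg
  have hle : bmoNorm g ≤ (32 * K * bmoNorm g) ^ (1 / 2 : ℝ) := by
    refine bmoNorm_le fun Ω _ _ hΩ s hs => ?_
    rw [← ENNReal.rpow_two, ← ENNReal.rpow_mul]
    norm_num
    -- The test distribution: its image is the sweep of the `g_R²` over `s`, whose integral is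
    -- exactly the sum to be bounded.
    set f : DyadicDistribution := fun R => if R ∈ s then g R else 0 with hf
    have hfG : bmoNorm f ≤ bmoNorm g := by
      refine bmoNorm_le fun Ω' _ _ hΩ' t ht => ?_
      refine (Finset.sum_le_sum fun R _ => ?_).trans (sum_sq_le hG hΩ'.ne ht)
      refine ENNReal.ofReal_le_ofReal ?_
      simp only [hf]
      split_ifs
      · exact le_rfl
      · simpa using sq_nonneg (g R)
    set F : ℝ × ℝ → ℝ := fun x => ∑ R ∈ s, (f R * g R / R.area) * R.ind x with hFdef
    have hpi : piStar g f = haarCoeff F := by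
      rw [piStar, piStarFun_eq (s := s)]
      intro R hR
      by_contra h
      exact left_ne_zero_of_mul hR (if_neg h)
    have hN : bmoNorm (haarCoeff F) ≤ K * bmoNorm g := by
      rw [← hpi]
      refine (hK f (lt_of_le_of_lt hfG hG.lt_top)).trans ?_
      gcongr
    have hKG : (K : ℝ≥0∞) * bmoNorm g ≠ ∞ := ENNReal.mul_ne_top ENNReal.coe_ne_top hG
    have hF : MemLp F 2 volume := memLp_finsetSum _ fun S _ => S.memLp_ind.const_mul _
    have hsupp : ∀ x ∉ rectUnion s, F x = 0 := fun x hx => by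
      refine Finset.sum_eq_zero fun R hR => ?_
      rw [R.ind_eq, Set.indicator_of_notMem, mul_zero]
      exact fun h => hx (Set.mem_biUnion (s := (s : Set DyadicRectangle)) hR h)
    have hB : ∫ x, F x = ∑ R ∈ s, g R ^ 2 := by
      have hint : ∀ R : DyadicRectangle, ∫ x, R.ind x = R.area := fun R => by
        simp only [DyadicRectangle.ind]
        refine (integral_prod_mul R.1.ind R.2.ind).trans ?_
        rw [integral_ind, integral_ind]
        rfl
      rw [hFdef, integral_finsetSum _ fun R _ =>
        (R.1.integrable_ind.mul_prod R.2.integrable_ind).const_mul _]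
      refine Finset.sum_congr rfl fun R hR => ?_
      rw [integral_const_mul, hint, div_mul_cancel₀ _ R.area_pos.ne', hf]
      simp only [if_pos hR]
      ring
    have hΩs : volume (rectUnion s) ≤ volume Ω := measure_mono (Set.iUnion₂_subset hs)
    have hcs := sq_integral_le hF (volume_rectUnion_ne_top s) hsupp
    have hkey := ofReal_integral_sq_le s (fun R => f R * g R / R.area)
      (hN.trans_lt hKG.lt_top).ne
    rw [hB] at hcs
    have hB0 : 0 ≤ ∑ R ∈ s, g R ^ 2 := Finset.sum_nonneg fun _ _ => sq_nonneg _
    rw [← ENNReal.ofReal_sum_of_nonneg fun _ _ => sq_nonneg _]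
    have hsq : ENNReal.ofReal (∑ R ∈ s, g R ^ 2) ^ 2
        ≤ (32 * K * bmoNorm g * volume Ω) ^ 2 := by
      calc ENNReal.ofReal (∑ R ∈ s, g R ^ 2) ^ 2
          = ENNReal.ofReal ((∑ R ∈ s, g R ^ 2) ^ 2) := (ENNReal.ofReal_pow hB0 2).symm
        _ ≤ ENNReal.ofReal ((volume (rectUnion s)).toReal * ∫ x, F x ^ 2) :=
            ENNReal.ofReal_le_ofReal hcs
        _ = volume (rectUnion s) * ENNReal.ofReal (∫ x, F x ^ 2) := by
            rw [ENNReal.ofReal_mul ENNReal.toReal_nonneg,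
              ENNReal.ofReal_toReal (volume_rectUnion_ne_top s)]
        _ ≤ volume (rectUnion s)
              * (512 * (bmoNorm (haarCoeff F) ^ 2 * volume (rectUnion s))) := by gcongr
        -- Rounding 512 up to `1024 = 32²` makes the bound a perfect square.
        _ ≤ volume Ω * (1024 * ((K * bmoNorm g) ^ 2 * volume Ω)) := by
            gcongr
            norm_num
        _ = (32 * K * bmoNorm g * volume Ω) ^ 2 := by ring
    exact (ENNReal.pow_le_pow_left_iff two_ne_zero).mp hsq
  rw [one_div, ENNReal.le_rpow_inv_iff two_pos, ENNReal.rpow_two, pow_two] at hle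
  -- At this point `‖g‖² ≤ 32 K ‖g‖`, and a finite nonzero `‖g‖` cancels.
  rcases eq_or_ne (bmoNorm g) 0 with h0 | h0
  · rw [h0]
    exact zero_le
  · exact (ENNReal.mul_le_mul_iff_left h0 hG).mp hle

end BiParam

theorem mainTheorem2 :
    ∃ c C : ℝ≥0, 0 < c ∧ 0 < C ∧
      ∀ g : ℝ × ℝ → ℝ, LocallyIntegrable g volume →
        {R : BiParam.DyadicRectangle | BiParam.haarCoeff g R ≠ 0}.Finite →
          (c : ℝ≥0∞) * BiParam.bmoNorm (BiParam.haarCoeff g)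
              ≤ BiParam.bmoOpNorm (BiParam.piStar (BiParam.haarCoeff g)) ∧
          BiParam.bmoOpNorm (BiParam.piStar (BiParam.haarCoeff g))
              ≤ (C : ℝ≥0∞) * BiParam.bmoNorm (BiParam.haarCoeff g) := by
  refine ⟨32⁻¹, 8, by norm_num, by norm_num, fun g _ hg => ⟨?_, ?_⟩⟩
  · refine le_iInf₂ fun K hK => ?_
    have h := BiParam.bmoNorm_le_of_piStar_le hg hK
    rw [ENNReal.coe_inv (by norm_num), ENNReal.inv_mul_le_iff (by simp) (by simp)]
    simpa using h
  · have hG := BiParam.bmoNorm_ne_top_of_finite hg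
    refine iInf₂_le_of_le (8 * (BiParam.bmoNorm (BiParam.haarCoeff g)).toNNReal)
      (fun f hf => ?_) ?_
    · refine (BiParam.bmoNorm_piStar_le hg (ne_of_lt hf) hG).trans_eq ?_
      rw [ENNReal.coe_mul, ENNReal.coe_toNNReal hG, ENNReal.coe_ofNat]
      ring
    · rw [ENNReal.coe_mul, ENNReal.coe_toNNReal hG]
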